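/- **Theorem 3.3 (Continuity of the Itô–Lyons map).** *The integral.* Let $t_{k,n}=n2^{-k}$ and, for continuous $g$, $h_{k,n}(g)=2^k\int_{t_{k,n}}^{t_{k,n+1}}g(\tau)\,d\tau$. For $0\le a\le b\le 1$ and $k\ge 1$ let $N_k(a,b)$ be the set of the integers $0\le n\le 2^k$ with $[t_{k-1,\lfloor n/2\rfloor},t_{k-1,\lfloor n/2\rfloor+1}]\subset[a,b]$; it consists of consecutive integers. Define $$\int_a^b f(t,g(t))\,dg(t)=\lim_{k\to\infty}\ \sum_{n-1,\,n\in N_k(a,b)}\ \int_{h_{k,n-1}(g)}^{h_{k,n}(g)}f(t_{k,n},\xi)\,d\xi ,$$ whenever the limit exists. *Seminorms.* Let $0<T\le 1$. Put $|f,H_\beta|=|f,H_\beta([0,T])|=\sup_{t\ne u\in[0,T]}|f(t)-f(u)|/|t-u|^\beta$ and $|f,\mathcal C|=\sup_{t\in[0,T]}|f(t)|$. For $x:[0,T]\to\mathbb R^d$ put $$|x,G_{\beta,\gamma}|=\sup\ \frac{1}{(b-a)^{\beta+\gamma}}\sum_{k=k_0+1}^\infty 2^{-(k+1)\beta}\sum_{n:\,[t_{k,n-1},t_{k,n}]\subset[a,b]}\bigl|h_{k+1,2(n-1)}(x_j)-h_{k+1,2(n-1)+1}(x_j)\bigr|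 ,$$ where the supremum is over $0\le a<b\le T$, $1\le j\le d$ and the integers $k_0\ge 0$ with $2^{-k_0-1}\le b-a\le 2^{-k_0+1}$. *Solutions.* Let $F=(F_{ij}):[0,T]\times\mathbb R^m\times\mathbb R^d\to\mathcal L(\mathbb R^d,\mathbb R^m)$. For $y:[0,T]\to\mathbb R^m$ and $x:[0,T]\to\mathbb R^d$ write $$F^{y,x}_{ij}(t,\xi)=F_{ij}(t,y(t),x_1(t),\dots,x_{j-1}(t),\xi,x_{j+1}(t),\dots,x_d(t)).$$ An $H_\beta$ solution of $dy=F(t,y,x)\,dx$, $y(0)=y_0$, on $[0,T]$ is a function $y$ with $|y,H_\beta|<\infty$ such that for all $t\in[0,T]$ and all $i$ the following integrals exist and $$y_i(t)=y_{0,i}+\sum_{j=1}^d\int_0^tF^{y,x}_{ij}(u,x_j(u))\,dx_j(u).$$ Put $$|F,H_\beta|_{y,x}=\max_{i,j}\ \sup_{\xi\in x_j([0,T])}|F^{y,x}_{ij}(\cdot,\xi),H_\beta|,\qquad |F,\mathcal C|_{y,x}=\max_{i,j}\ \sup_{\xi\in x_j([0,T])}|F^{y,x}_{ij}(\cdot,\xi),\mathcal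 C| .$$ *Claim.* Let $m,d\ge 0$ be integers, $0<T\le1$, $0<\beta\le\alpha\le1$, $0<\theta\le1$, $\gamma>0$, and $0<\beta-\gamma<\beta_0<\theta\beta$. For all $M\in\mathbb R$ and $K\ge 0$ there is a constant $C\ge 0$, depending only on $m,d,T,\alpha,\beta,\beta_0,\gamma,\theta,M,K$, with the following property. Let $U\subset\mathbb R^m$ be convex, and let $(x,F,y_0)$, $(\tilde x,\tilde F,\tilde y_0)$ be inputs such that * $F_{ij}$ and $\tilde F_{ij}$ are continuously differentiable in $(t,y,x)\in[0,T]\times\mathbb R^m\times\mathbb R^d$ for all $i,j$; on $[0,T]\times U\times[-M,M]^d$ each of them, its derivative, and the $\theta$-Hölder seminorm of its derivative are bounded by $K$; * $x,\tilde x:[0,T]\to[-M,M]^d$, and the numbers $|x,H_\alpha|$, $|\tilde x,H_\alpha|$, $|x,G_{\beta_0,\gamma}|$, $|\tilde x,G_{\beta_0,\gamma}|$ are at most $K$. Let $y$ and $\tilde y$ be $H_\beta$ solutions on $[0,T]$ for the inputs $(x,F,y_0)$ and $(\tilde x,\tilde F,\tilde y_0)$, with values in $U$. Then $$|y-\tilde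 y,H_\beta|\le C\bigl(|y_0-\tilde y_0|+|\tilde x-x,G_{\beta,\gamma}|+|x-\tilde x,H_\alpha|+|x-\tilde x,\mathcal C|+|F-\tilde F,H_\beta|_{y,x}+|F-\tilde F,\mathcal C|_{y,x}\bigr).$$ (For $U=\mathbb R^m$ the constant depends only on bounds for the inputs. If the bounds on $F,\tilde F$ are only local, take for $U$ a ball that contains the values of the two solutions.) -/

import Mathlib

open Set Filter Topology MeasureTheory
open scoped NNReal ENNReal

noncomputable section

namespace IrregularPath

/-- The Euclidean space `ℝⁿ`. -/
abbrev E (n : ℕ) : Type := EuclideanSpace ℝ (Fin n)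

/-! ### The integral along an irregular path -/

/-- The dyadic point `t_{k,n} = n 2^{-k}`. -/
def dyadic (k n : ℕ) : ℝ := (n : ℝ) / 2 ^ k

/-- The dyadic average `h_{k,n}(g) = 2^k ∫_{t_{k,n}}^{t_{k,n+1}} g`. -/
def avg (g : ℝ → ℝ) (k n : ℕ) : ℝ :=
  2 ^ k * ∫ τ in dyadic k n..dyadic k (n + 1), g τ

/-- The set `[n_k(a), n_k(b)]` of all `0 ≤ n ≤ 2^k` such that the parent
`[t_{k-1,⌊n/2⌋}, t_{k-1,⌊n/2⌋+1}]` of the cell `[t_{k,n}, t_{k,n+1}]` lies in `[a, b]`.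
It is a set of consecutive integers. It is used for `k ≥ 1` only. -/
def cells (k : ℕ) (a b : ℝ) : Finset ℕ :=
  (Finset.range (2 ^ k + 1)).filter
    (fun n => a ≤ dyadic (k - 1) (n / 2) ∧ dyadic (k - 1) (n / 2 + 1) ≤ b)

/-- The line integral of `f(t, ξ) dξ` over the polygon `γ_k(a, b, g)`, which is
`∑_{n = n_k(a)+1}^{n_k(b)} ∫_{h_{k,n-1}}^{h_{k,n}} f(t_{k,n}, ξ) dξ`
(here with `n` replaced by `n + 1`). -/
def polygonIntegral (f : ℝ → ℝ → ℝ) (g : ℝ → ℝ) (a b : ℝ) (k : ℕ) : ℝ :=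
  ∑ n ∈ (cells k a b).filter (fun n => n + 1 ∈ cells k a b),
    ∫ ξ in avg g k n..avg g k (n + 1), f (dyadic k (n + 1)) ξ

/-- The integral `∫_a^b f(t, g(t)) dg(t)` exists and equals `I`. -/
def HasPathIntegral (f : ℝ → ℝ → ℝ) (g : ℝ → ℝ) (a b I : ℝ) : Prop :=
  Tendsto (polygonIntegral f g a b) atTop (𝓝 I)

/-! ### Function classes -/

/-- The Hölder seminorm `|f, H_β([0,T])| = sup_{t ≠ u} |f(t) - f(u)| / |t - u|^β`. -/
def holderSeminorm {V : Type*} [NormedAddCommGroup V] (β T : ℝ) (f : ℝ → V) : ℝ≥0∞ :=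
  eHolderNorm β.toNNReal ((Icc (0 : ℝ) T).domRestrict f)

/-- The sup norm `|f, C([0,T])|`. -/
def supNorm {V : Type*} [NormedAddCommGroup V] (T : ℝ) (f : ℝ → V) : ℝ≥0∞ :=
  ⨆ t ∈ Icc (0 : ℝ) T, ‖f t‖ₑ

/-- `μ(g, a, b, β) = ∑_{k > k₀} 2^{-(k+1)β} ∑_{n : [t_{k,n-1}, t_{k,n}] ⊆ [a,b]}
|h_{k+1,2(n-1)}(g) - h_{k+1,2(n-1)+1}(g)|`; the index `n` is shifted by one, and the
index `k` is `k₀ + 1 + l`. -/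
def levyMu (g : ℝ → ℝ) (a b β : ℝ) (k₀ : ℕ) : ℝ≥0∞ :=
  ∑' l : ℕ, ENNReal.ofReal
    ((2 : ℝ) ^ (-((k₀ + 1 + l + 1 : ℕ) : ℝ) * β) *
      ∑ n ∈ (Finset.range (2 ^ (k₀ + 1 + l))).filter
          (fun n => a ≤ dyadic (k₀ + 1 + l) n ∧ dyadic (k₀ + 1 + l) (n + 1) ≤ b),
        |avg g (k₀ + 1 + l + 1) (2 * n) - avg g (k₀ + 1 + l + 1) (2 * n + 1)|)

/-- The seminorm `|x, G_{β,γ}([0,T])|`: the supremum of `μ(x_j, a, b, β) / (b - a)^{β+γ}` over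
`0 ≤ a < b ≤ T`, over the components `x_j`, and over the integers `k₀ ≥ 0` with
`2^{-k₀-1} ≤ b - a ≤ 2^{-k₀+1}`. -/
def gSeminorm {d : ℕ} (β γ T : ℝ) (x : ℝ → E d) : ℝ≥0∞ :=
  ⨆ (j : Fin d) (a : ℝ) (b : ℝ) (_ : 0 ≤ a ∧ a < b ∧ b ≤ T)
    (k₀ : ℕ) (_ : (1 / 2 : ℝ) ^ (k₀ + 1) ≤ b - a ∧ b - a ≤ 2 * (1 / 2 : ℝ) ^ k₀),
    levyMu (fun t => x t j) a b β k₀ / ENNReal.ofReal ((b - a) ^ (β + γ))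

/-- The set of times and states `[0,T] × U × {v : |v_j| ≤ M for all j}`. -/
def cylinder {m : ℕ} (d : ℕ) (T : ℝ) (U : Set (E m)) (M : ℝ) : Set (ℝ × E m × E d) :=
  Icc (0 : ℝ) T ×ˢ U ×ˢ {v : E d | ∀ j, |v j| ≤ M}

/-- `f(t, y, x)` is continuously differentiable in `(t, y, x)`, `t ∈ [0,T]` (one-sided
derivatives in `t` at the end points), and on the set `[0,T] × U × [-M,M]^d` the function `f`, its
derivative, and the `θ`-Hölder seminorm of its derivative are bounded by `K`. -/
structure IsC1Holder {m d : ℕ} (T θ : ℝ) (U : Set (E m)) (M : ℝ) (K : ℝ≥0)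
    (f : ℝ × E m × E d → ℝ) : Prop where
  contDiffOn : ContDiffOn ℝ 1 f (Icc (0 : ℝ) T ×ˢ univ)
  norm_le : ∀ p ∈ cylinder d T U M, |f p| ≤ K
  deriv_le : ∀ p ∈ cylinder d T U M, ‖fderivWithin ℝ f (Icc (0 : ℝ) T ×ˢ univ) p‖ ≤ K
  deriv_holder : ∀ p ∈ cylinder d T U M, ∀ q ∈ cylinder d T U M,
    ‖fderivWithin ℝ f (Icc (0 : ℝ) T ×ˢ univ) p
      - fderivWithin ℝ f (Icc (0 : ℝ) T ×ˢ univ) q‖ ≤ K * ‖p - q‖ ^ θ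

/-! ### The differential equation -/

/-- `F(t, y, x)` as a linear map `ℝᵈ → ℝᵐ`, given by its matrix `(F_{ij})`. -/
abbrev Field (m d : ℕ) : Type := ℝ → E m → E d → Matrix (Fin m) (Fin d) ℝ

/-- The function `f(t, ξ) = F_{ij}(t, y(t), x_1(t), …, ξ, …, x_d(t))`, where `ξ` replaces
`x_j(t)`. -/
def slice {m d : ℕ} (F : Field m d) (y : ℝ → E m) (x : ℝ → E d) (i : Fin m) (j : Fin d)
    (t ξ : ℝ) : ℝ :=
  F t (y t) (WithLp.toLp 2 (Function.update (x t).ofLp j ξ)) i j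

/-- `y` is an `H_β` solution on `[0,T]` of `dy = F(t, y, x) dx`, `y(0) = y₀`: `y` is in
`H_β([0,T])`, and for all `t ∈ [0,T]` and all `i` the integrals exist in
`y_i(t) = y_{0,i} + ∑_j ∫_0^t F_{ij}(u, y(u), x(u)) dx_j(u)` and the equality holds. -/
structure IsSolution {m d : ℕ} (β T : ℝ) (x : ℝ → E d) (F : Field m d) (y₀ : E m)
    (y : ℝ → E m) : Prop where
  holder : holderSeminorm β T y < ⊤
  integral_eq : ∀ t ∈ Icc (0 : ℝ) T, ∃ I : Fin m → Fin d → ℝ,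
    (∀ i j, HasPathIntegral (slice F y x i j) (fun s => x s j) 0 t (I i j)) ∧
    ∀ i, y t i = y₀ i + ∑ j, I i j

/-- `|F, H_β([0,T])|` along `(y, x)`: the largest of the Hölder seminorms in time
`sup_ξ |f_{ij}(·, ξ), H_β([0,T])|`, where `f_{ij}(t, ξ) = F_{ij}(t, y(t), x_1(t), …, ξ, …, x_d(t))`
and `ξ` runs over the range of `x_j` on `[0,T]`. -/
def fieldHolder {m d : ℕ} (β T : ℝ) (y : ℝ → E m) (x : ℝ → E d) (F : Field m d) : ℝ≥0∞ :=
  ⨆ (i : Fin m) (j : Fin d) (ξ ∈ (fun s => x s j) '' Icc (0 : ℝ) T),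
    holderSeminorm β T (fun t => slice F y x i j t ξ)

/-- `|F, C|` along `(y, x)`: the largest of `sup_{t,ξ} |f_{ij}(t, ξ)|`, with the same `f_{ij}` and
the same range of `ξ` as in `fieldHolder`. -/
def fieldSup {m d : ℕ} (T : ℝ) (y : ℝ → E m) (x : ℝ → E d) (F : Field m d) : ℝ≥0∞ :=
  ⨆ (i : Fin m) (j : Fin d) (ξ ∈ (fun s => x s j) '' Icc (0 : ℝ) T),
    supNorm T (fun t => slice F y x i j t ξ)

end IrregularPath

end

/-!
The integral over `[a, b]` is compared with that over a coarse polygon of scale `b - a`, which has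
at most four edges. Passing from the polygon of level `k` to that of level `k + 1`, the vertex
`h_{k,n}` is the midpoint of the edge from `h_{k+1,2n}` to `h_{k+1,2n+1}`; since everything happens
on a line, the two polygonal integrals differ only through the times at which the integrand is
frozen on these edges, and through the ends (`abs_edgeSum_succ_sub_le`). So the change of level
costs the Hölder seminorm in time of the integrand times the sum that defines `levyMu`, and no
regularity in space is needed. Carrying this out for a pair of integrals at once gives the stability
estimate `abs_pathIntegral_sub_le`: a difference of integrands enters through its Hölder seminorm,
a difference of paths through its own `levyMu`, and through its supremum times the mixed increments
in time and space of the integrand.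

For two solutions the integrands are values of the fields along the solutions. As the fields have
`θ`-Hölder derivatives, the mixed second differences of `IsC1Holder.abs_sub_sub_sub_le` show that the
change of the state in the field is `β₀`-Hölder in time, linearly in the `β`-Hölder size `H` of
`y - y'` (`norm_solution_sub_sub_le`). Because `β₀ + γ > β`, the terms with `H` in the increment over
`[a, b]` carry an additional positive power of `b - a`. On short intervals they can be absorbed
(`HolderOn.of_improvement`), where the length is uniform because the same argument first bounds the
Hölder constants of the solutions themselves (`IsSolution.holderOn`). Finitely many short intervals
cover `[0, T]`, and `HolderOn.of_local` puts the local estimates together.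
-/

namespace IrregularPath

/-! ### Dyadic cells inside an interval -/

/-- The index of the first cell of level `k` that lies to the right of `a`. -/
noncomputable def firstCell (a : ℝ) (k : ℕ) : ℕ := ⌈a * 2 ^ k⌉₊

/-- The index one past the last cell of level `k` that lies to the left of `b`. -/
noncomputable def endCell (b : ℝ) (k : ℕ) : ℕ := ⌊b * 2 ^ k⌋₊

lemma firstCell_le_iff {a : ℝ} {k n : ℕ} : firstCell a k ≤ n ↔ a ≤ dyadic k n := by
  rw [firstCell, Nat.ceil_le, dyadic, le_div_iff₀ (by positivity)]

lemma le_endCell_iff {b : ℝ} (hb : 0 ≤ b) {k n : ℕ} : n ≤ endCell b k ↔ dyadic k n ≤ b := by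
  rw [endCell, Nat.le_floor_iff (by positivity), dyadic, div_le_iff₀ (by positivity)]

lemma dyadic_mono (k : ℕ) {n n' : ℕ} (h : n ≤ n') : dyadic k n ≤ dyadic k n' := by
  unfold dyadic; gcongr

lemma dyadic_succ_two_mul (k n : ℕ) : dyadic (k + 1) (2 * n) = dyadic k n := by
  unfold dyadic; push_cast; field_simp; ring

lemma dyadic_succ_sub (k n : ℕ) : dyadic k (n + 1) - dyadic k n = (1 / 2) ^ k := by
  unfold dyadic; push_cast; rw [one_div, inv_pow]; field_simp; ring

lemma endCell_le_two_pow {b : ℝ} (hb0 : 0 ≤ b) (hb1 : b ≤ 1) (k : ℕ) : endCell b k ≤ 2 ^ k := by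
  have h := (le_endCell_iff hb0 (k := k)).1 le_rfl
  rw [dyadic, div_le_iff₀ (by positivity)] at h
  have : (endCell b k : ℝ) ≤ 2 ^ k := h.trans (by nlinarith [pow_pos (two_pos (α := ℝ)) k])
  exact_mod_cast this

lemma cells_succ {a b : ℝ} (hb0 : 0 ≤ b) (hb1 : b ≤ 1) (k : ℕ) :
    cells (k + 1) a b = Finset.Ico (2 * firstCell a k) (2 * endCell b k) := by
  ext n
  have h1 := endCell_le_two_pow hb0 hb1 k
  have h2 : firstCell a k ≤ n / 2 ↔ a ≤ dyadic k (n / 2) := firstCell_le_iff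
  have h3 : n / 2 + 1 ≤ endCell b k ↔ dyadic k (n / 2 + 1) ≤ b := le_endCell_iff hb0
  simp only [cells, Finset.mem_filter, Finset.mem_range, Nat.add_sub_cancel, Finset.mem_Ico,
    ← h2, ← h3, pow_succ]
  omega

lemma cells_succ_edges {a b : ℝ} (hb0 : 0 ≤ b) (hb1 : b ≤ 1) (k : ℕ) :
    (cells (k + 1) a b).filter (fun n => n + 1 ∈ cells (k + 1) a b) =
      Finset.Ico (2 * firstCell a k) (2 * endCell b k - 1) := by
  ext n
  simp only [cells_succ hb0 hb1, Finset.mem_filter, Finset.mem_Ico]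
  omega

lemma filter_cells_eq {a b : ℝ} (hb0 : 0 ≤ b) (hb1 : b ≤ 1) (k : ℕ) :
    (Finset.range (2 ^ k)).filter (fun n => a ≤ dyadic k n ∧ dyadic k (n + 1) ≤ b) =
      Finset.Ico (firstCell a k) (endCell b k) := by
  ext n
  have h1 := endCell_le_two_pow hb0 hb1 k
  simp only [Finset.mem_filter, Finset.mem_range, Finset.mem_Ico, ← firstCell_le_iff,
    ← le_endCell_iff hb0]
  omega

lemma firstCell_succ (a : ℝ) (k : ℕ) :
    firstCell a (k + 1) ≤ 2 * firstCell a k ∧ 2 * firstCell a k ≤ firstCell a (k + 1) + 1 := by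
  constructor
  · rw [firstCell_le_iff, dyadic_succ_two_mul, ← firstCell_le_iff]
  · have h : firstCell a k ≤ (firstCell a (k + 1) + 1) / 2 := by
      rw [firstCell_le_iff, ← dyadic_succ_two_mul]
      exact (firstCell_le_iff.1 le_rfl).trans (dyadic_mono _ (by omega))
    omega

lemma endCell_succ {b : ℝ} (hb : 0 ≤ b) (k : ℕ) :
    2 * endCell b k ≤ endCell b (k + 1) ∧ endCell b (k + 1) ≤ 2 * endCell b k + 1 := by
  constructor
  · rw [le_endCell_iff hb, dyadic_succ_two_mul, ← le_endCell_iff hb]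
  · have h : endCell b (k + 1) / 2 ≤ endCell b k := by
      rw [le_endCell_iff hb, ← dyadic_succ_two_mul]
      exact (dyadic_mono _ (by omega)).trans ((le_endCell_iff hb).1 le_rfl)
    omega

/-- The number of cells of level `k` in an interval is at most `2 ^ k` times its length. -/
lemma endCell_sub_firstCell_le {a b : ℝ} (hb : 0 ≤ b) (hab : a ≤ b) (k : ℕ) :
    ((endCell b k - firstCell a k : ℕ) : ℝ) ≤ (b - a) * 2 ^ k := by
  have h1 := (le_endCell_iff hb (k := k)).1 le_rfl
  have h2 := (firstCell_le_iff (a := a) (k := k)).1 le_rfl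
  rw [dyadic, div_le_iff₀ (by positivity)] at h1
  rw [dyadic, le_div_iff₀ (by positivity)] at h2
  rcases le_total (firstCell a k) (endCell b k) with h | h
  · rw [Nat.cast_sub h]; linarith
  · rw [Nat.sub_eq_zero_of_le h]
    have := sub_nonneg.2 hab
    push_cast; positivity

/-! ### Sums over the edges of the polygons -/

/-- The algebra behind the comparison of two consecutive polygons, with edge integrals `e'` on the
finer and `e` on the coarser one. An edge of the finer polygon with even index passes through a
coarse vertex and splits into two halves `l` and `r`; an edge of the coarser polygon consists of a
fine edge with odd index and two halves `r'` and `l'`. Only the differences of the halves, and two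
halves at the ends, remain. -/
lemma sum_edges_sub (e' e r l r' l' : ℕ → ℝ) (h_even : ∀ n, e' (2 * n) = r n + l n)
    (h_odd : ∀ n, e n = e' (2 * n + 1) + r' n + l' (n + 1)) (p j : ℕ) :
    ∑ n ∈ Finset.Ico (2 * p) (2 * (p + j + 1) - 1), e' n - ∑ n ∈ Finset.Ico p (p + j), e n =
      ∑ n ∈ Finset.Ico p (p + j), (r n - r' n)
        + ∑ n ∈ Finset.Ico (p + 1) (p + j + 1), (l n - l' n) + r (p + j) + l p := by
  induction j with
  | zero =>
    have : 2 * (p + 0 + 1) - 1 = 2 * p + 1 := by omega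
    simp [this, h_even]
  | succ j ih =>
    have h1 : 2 * (p + (j + 1) + 1) - 1 = 2 * (p + j + 1) - 1 + 1 + 1 := by omega
    have h2 : 2 * (p + j + 1) - 1 = 2 * (p + j) + 1 := by omega
    have h3 : 2 * (p + j) + 1 + 1 = 2 * (p + j + 1) := by ring
    rw [h1, Finset.sum_Ico_succ_top (by omega), Finset.sum_Ico_succ_top (by omega),
      ← Nat.add_assoc p j 1, Finset.sum_Ico_succ_top (by omega : p ≤ p + j),
      Finset.sum_Ico_succ_top (by omega : p ≤ p + j),
      Finset.sum_Ico_succ_top (by omega : p + 1 ≤ p + j + 1)]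
    have h4 : e' (2 * (p + j + 1) - 1) = e (p + j) - r' (p + j) - l' (p + j + 1) := by
      rw [h2, h_odd]; ring
    have h5 : e' (2 * (p + j + 1) - 1 + 1) = r (p + j + 1) + l (p + j + 1) := by
      rw [h2, h3, h_even]
    rw [h4, h5]
    linarith

lemma abs_sum_sub_sum_le {s t u : Finset ℕ} {e : ℕ → ℝ} {ρ : ℝ} (hts : t ⊆ s) (hu : s \ t ⊆ u)
    (hρ : 0 ≤ ρ) (h : ∀ n ∈ s, |e n| ≤ ρ) : |∑ n ∈ s, e n - ∑ n ∈ t, e n| ≤ u.card * ρ := by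
  rw [← Finset.sum_sdiff hts, add_sub_cancel_right]
  calc |∑ n ∈ s \ t, e n| ≤ ∑ n ∈ s \ t, |e n| := Finset.abs_sum_le_sum_abs _ _
    _ ≤ (s \ t).card • ρ := Finset.sum_le_card_nsmul _ _ _
        fun n hn => h n (Finset.mem_sdiff.1 hn).1
    _ ≤ u.card * ρ := by
        rw [nsmul_eq_mul]
        gcongr

/-- The sum of the edges `A(t_{k,n+1}, v_{k,n+1}) - A(t_{k,n+1}, v_{k,n})` of the polygon of level
`k` with vertices `v_{k,n}`, where `A` is a time dependent potential. The polygon is that of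
`polygonIntegral`. -/
noncomputable def edgeSum {V : Type*} (A : ℝ → V → ℝ) (v : ℕ → ℕ → V) (a b : ℝ) (k : ℕ) : ℝ :=
  ∑ n ∈ (cells k a b).filter (fun n => n + 1 ∈ cells k a b),
    (A (dyadic k (n + 1)) (v k (n + 1)) - A (dyadic k (n + 1)) (v k n))

/-- The comparison of two consecutive polygons: a half edge next to the vertex `v_{k,n}` enters
both sums, at two times that are `2^{-(k+1)}` apart. Up to boundary terms, only these time
differences remain. -/
lemma abs_edgeSum_succ_sub_le {V : Type*} (A : ℝ → V → ℝ) (v : ℕ → ℕ → V) {a b : ℝ}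
    (hb0 : 0 ≤ b) (hb1 : b ≤ 1) (ρ : ℕ → ℝ) (ε : ℕ → ℕ → ℝ) (hρ : ∀ k, 0 ≤ ρ k)
    (h_edge : ∀ k n, firstCell a k ≤ n → n + 2 ≤ endCell b k →
      |A (dyadic k (n + 1)) (v k (n + 1)) - A (dyadic k (n + 1)) (v k n)| ≤ ρ k)
    (h_right : ∀ k n, firstCell a k ≤ n → n + 1 ≤ endCell b k →
      |A (dyadic (k + 1) (2 * n + 1)) (v (k + 1) (2 * n + 1))
        - A (dyadic (k + 1) (2 * n + 1)) (v k n)| ≤ ρ (k + 1))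
    (h_left : ∀ k n, firstCell a k ≤ n → n + 1 ≤ endCell b k →
      |A (dyadic (k + 1) (2 * n + 1)) (v k n)
        - A (dyadic (k + 1) (2 * n + 1)) (v (k + 1) (2 * n))| ≤ ρ (k + 1))
    (h_right' : ∀ k n, firstCell a k ≤ n → n + 1 ≤ endCell b k →
      |(A (dyadic (k + 1) (2 * n + 1)) (v (k + 1) (2 * n + 1))
        - A (dyadic (k + 1) (2 * n + 1)) (v k n))
        - (A (dyadic k (n + 1)) (v (k + 1) (2 * n + 1)) - A (dyadic k (n + 1)) (v k n))| ≤ ε k n)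
    (h_left' : ∀ k n, firstCell a k ≤ n → n + 1 ≤ endCell b k →
      |(A (dyadic (k + 1) (2 * n + 1)) (v k n)
        - A (dyadic (k + 1) (2 * n + 1)) (v (k + 1) (2 * n)))
        - (A (dyadic k n) (v k n) - A (dyadic k n) (v (k + 1) (2 * n)))| ≤ ε k n) (k : ℕ) :
    |edgeSum A v a b (k + 2) - edgeSum A v a b (k + 1)| ≤
      2 * ∑ n ∈ Finset.Ico (firstCell a (k + 1)) (endCell b (k + 1)), ε (k + 1) n
        + 2 * ρ (k + 2) + 2 * ρ (k + 1) := by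
  unfold edgeSum
  rw [cells_succ_edges hb0 hb1, cells_succ_edges hb0 hb1]
  obtain ⟨hp1, hp2⟩ := firstCell_succ a k
  obtain ⟨hq1, hq2⟩ := endCell_succ hb0 k
  set p := firstCell a (k + 1) with hp
  set q := endCell b (k + 1) with hq
  set e : ℕ → ℝ := fun n => A (dyadic (k + 1) (n + 1)) (v (k + 1) (n + 1))
    - A (dyadic (k + 1) (n + 1)) (v (k + 1) n) with he
  set e' : ℕ → ℝ := fun n => A (dyadic (k + 2) (n + 1)) (v (k + 2) (n + 1))
    - A (dyadic (k + 2) (n + 1)) (v (k + 2) n) with he'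
  have hε : ∀ n ∈ Finset.Ico p q, 0 ≤ ε (k + 1) n := fun n hn =>
    (abs_nonneg _).trans (h_right' (k + 1) n (Finset.mem_Ico.1 hn).1 (Finset.mem_Ico.1 hn).2)
  have h1 : |∑ n ∈ Finset.Ico p (q - 1), e n
      - ∑ n ∈ Finset.Ico (2 * firstCell a k) (2 * endCell b k - 1), e n| ≤ 2 * ρ (k + 1) := by
    have hcard : (({p, q - 2} : Finset ℕ).card : ℝ) ≤ 2 := by
      exact_mod_cast Finset.card_le_two
    refine (abs_sum_sub_sum_le (u := {p, q - 2}) ?_ ?_ (hρ _) ?_).trans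
      (mul_le_mul_of_nonneg_right hcard (hρ _))
    · intro n; simp only [Finset.mem_Ico]; omega
    · intro n
      simp only [Finset.mem_Ico, Finset.mem_sdiff, Finset.mem_insert, Finset.mem_singleton]
      omega
    · intro n hn
      rw [Finset.mem_Ico] at hn
      exact h_edge (k + 1) n hn.1 (by omega)
  have h2 : |∑ n ∈ Finset.Ico (2 * p) (2 * q - 1), e' n - ∑ n ∈ Finset.Ico p (q - 1), e n| ≤
      2 * ∑ n ∈ Finset.Ico p q, ε (k + 1) n + 2 * ρ (k + 2) := by
    rcases Nat.lt_or_ge p q with hpq | hpq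
    · obtain ⟨j, hj⟩ : ∃ j, q = p + j + 1 := ⟨q - p - 1, by omega⟩
      have hj' : q - 1 = p + j := by omega
      rw [hj', hj, sum_edges_sub e' e
        (fun n => A (dyadic (k + 2) (2 * n + 1)) (v (k + 2) (2 * n + 1))
          - A (dyadic (k + 2) (2 * n + 1)) (v (k + 1) n))
        (fun n => A (dyadic (k + 2) (2 * n + 1)) (v (k + 1) n)
          - A (dyadic (k + 2) (2 * n + 1)) (v (k + 2) (2 * n)))
        (fun n => A (dyadic (k + 1) (n + 1)) (v (k + 2) (2 * n + 1))
          - A (dyadic (k + 1) (n + 1)) (v (k + 1) n))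
        (fun n => A (dyadic (k + 1) n) (v (k + 1) n)
          - A (dyadic (k + 1) n) (v (k + 2) (2 * n)))
        (fun n => by simp only [he']; ring)
        (fun n => by
          simp only [he', he]
          rw [show 2 * n + 1 + 1 = 2 * (n + 1) by ring, dyadic_succ_two_mul]
          ring)]
      have hs1 : Finset.Ico p (p + j) ⊆ Finset.Ico p q := by
        intro n; simp only [Finset.mem_Ico]; omega
      have hs2 : Finset.Ico (p + 1) (p + j + 1) ⊆ Finset.Ico p q := by
        intro n; simp only [Finset.mem_Ico]; omega
      have hle : ∀ (s : Finset ℕ) (f : ℕ → ℝ), s ⊆ Finset.Ico p q →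
          (∀ n ∈ Finset.Ico p q, |f n| ≤ ε (k + 1) n) →
          |∑ n ∈ s, f n| ≤ ∑ n ∈ Finset.Ico p q, ε (k + 1) n := fun s f hs hf =>
        (Finset.abs_sum_le_sum_abs _ _).trans
          ((Finset.sum_le_sum fun n hn => hf n (hs hn)).trans
            (Finset.sum_le_sum_of_subset_of_nonneg hs fun n hn _ => hε n hn))
      have hr := hle _ (fun n => A (dyadic (k + 2) (2 * n + 1)) (v (k + 2) (2 * n + 1))
          - A (dyadic (k + 2) (2 * n + 1)) (v (k + 1) n)
          - (A (dyadic (k + 1) (n + 1)) (v (k + 2) (2 * n + 1))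
          - A (dyadic (k + 1) (n + 1)) (v (k + 1) n))) hs1 fun n hn =>
        h_right' (k + 1) n (Finset.mem_Ico.1 hn).1 (Finset.mem_Ico.1 hn).2
      have hl := hle _ (fun n => A (dyadic (k + 2) (2 * n + 1)) (v (k + 1) n)
          - A (dyadic (k + 2) (2 * n + 1)) (v (k + 2) (2 * n))
          - (A (dyadic (k + 1) n) (v (k + 1) n)
          - A (dyadic (k + 1) n) (v (k + 2) (2 * n)))) hs2 fun n hn =>
        h_left' (k + 1) n (Finset.mem_Ico.1 hn).1 (Finset.mem_Ico.1 hn).2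
      have hr1 := h_right (k + 1) (p + j) (by omega) (by omega)
      have hl1 := h_left (k + 1) p (by omega) (by omega)
      rw [← hj] at hl ⊢
      refine (abs_add_le _ _).trans ?_
      have := (abs_add_le (∑ n ∈ Finset.Ico p (p + j), _ + ∑ n ∈ Finset.Ico (p + 1) q, _)
        _).trans (add_le_add ((abs_add_le _ _).trans (add_le_add hr hl)) hr1)
      linarith
    · rw [Finset.Ico_eq_empty (by omega), Finset.Ico_eq_empty (by omega),
        Finset.Ico_eq_empty (by omega)]
      simpa using hρ _
  have h3 := abs_sub_le (∑ n ∈ Finset.Ico (2 * p) (2 * q - 1), e' n)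
    (∑ n ∈ Finset.Ico p (q - 1), e n)
    (∑ n ∈ Finset.Ico (2 * firstCell a k) (2 * endCell b k - 1), e n)
  linarith

/-- The polygon of the first level has at most four edges. -/
lemma abs_edgeSum_first_le {V : Type*} (A : ℝ → V → ℝ) (v : ℕ → ℕ → V) {a b : ℝ}
    (hb0 : 0 ≤ b) (hb1 : b ≤ 1) (hab : a ≤ b) {k₀ : ℕ} (hk : b - a ≤ 2 * (1 / 2 : ℝ) ^ k₀)
    {ρ : ℝ} (hρ : 0 ≤ ρ)
    (h_edge : ∀ n, firstCell a (k₀ + 1) ≤ n → n + 2 ≤ endCell b (k₀ + 1) →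
      |A (dyadic (k₀ + 1) (n + 1)) (v (k₀ + 1) (n + 1))
        - A (dyadic (k₀ + 1) (n + 1)) (v (k₀ + 1) n)| ≤ ρ) :
    |edgeSum A v a b (k₀ + 1)| ≤ 4 * ρ := by
  unfold edgeSum
  rw [cells_succ_edges hb0 hb1]
  obtain ⟨hp1, hp2⟩ := firstCell_succ a k₀
  obtain ⟨hq1, hq2⟩ := endCell_succ hb0 k₀
  have hc : (Finset.Ico (2 * firstCell a k₀) (2 * endCell b k₀ - 1)).card ≤ 4 := by
    have h := endCell_sub_firstCell_le hb0 hab k₀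
    have h1 : (b - a) * 2 ^ k₀ ≤ 2 := by
      calc (b - a) * 2 ^ k₀ ≤ 2 * (1 / 2 : ℝ) ^ k₀ * 2 ^ k₀ := by gcongr
        _ = 2 := by rw [mul_assoc, ← mul_pow]; norm_num
    have h2 : endCell b k₀ - firstCell a k₀ ≤ 2 := by exact_mod_cast h.trans h1
    rw [Nat.card_Ico]; omega
  refine (Finset.abs_sum_le_sum_abs _ _).trans ((Finset.sum_le_card_nsmul _ _ ρ ?_).trans ?_)
  · intro n hn
    rw [Finset.mem_Ico] at hn
    exact h_edge n (by omega) (by omega)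
  · rw [nsmul_eq_mul]
    have : ((Finset.Ico (2 * firstCell a k₀) (2 * endCell b k₀ - 1)).card : ℝ) ≤ 4 := by
      exact_mod_cast hc
    gcongr

/-! ### Dyadic averages -/

lemma dyadic_lt_succ (k n : ℕ) : dyadic k n < dyadic k (n + 1) := by
  unfold dyadic; gcongr; simp

lemma exists_avg_eq {g : ℝ → ℝ} {k n : ℕ}
    (hg : ContinuousOn g (Icc (dyadic k n) (dyadic k (n + 1)))) :
    ∃ c ∈ Icc (dyadic k n) (dyadic k (n + 1)), avg g k n = g c := by
  have h := dyadic_lt_succ k n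
  obtain ⟨c, hc, hgc⟩ := exists_eq_interval_average h.ne (by rwa [uIcc_of_le h.le])
  refine ⟨c, by simpa [uIcc_of_le h.le] using uIoo_subset_uIcc_self hc, ?_⟩
  rw [hgc, interval_average_eq, dyadic_succ_sub, avg, smul_eq_mul]
  simp

lemma avg_sub {g g' : ℝ → ℝ} {k n : ℕ}
    (hg : ContinuousOn g (Icc (dyadic k n) (dyadic k (n + 1))))
    (hg' : ContinuousOn g' (Icc (dyadic k n) (dyadic k (n + 1)))) :
    avg (fun t => g t - g' t) k n = avg g k n - avg g' k n := by
  have h := (dyadic_lt_succ k n).le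
  rw [avg, intervalIntegral.integral_sub, mul_sub, avg, avg]
  · exact ContinuousOn.intervalIntegrable (by rwa [uIcc_of_le h])
  · exact ContinuousOn.intervalIntegrable (by rwa [uIcc_of_le h])

lemma avg_eq_half {g : ℝ → ℝ} {k n : ℕ}
    (hg : ContinuousOn g (Icc (dyadic k n) (dyadic k (n + 1)))) :
    avg g k n = (avg g (k + 1) (2 * n) + avg g (k + 1) (2 * n + 1)) / 2 := by
  have h1 := (dyadic_lt_succ (k + 1) (2 * n)).le
  have h2 := (dyadic_lt_succ (k + 1) (2 * n + 1)).le
  have e1 := dyadic_succ_two_mul k n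
  have e2 : dyadic (k + 1) (2 * n + 1 + 1) = dyadic k (n + 1) := dyadic_succ_two_mul k (n + 1)
  have i1 : IntervalIntegrable g volume (dyadic (k + 1) (2 * n)) (dyadic (k + 1) (2 * n + 1)) := by
    refine ContinuousOn.intervalIntegrable (hg.mono ?_)
    rw [uIcc_of_le h1, ← e1, ← e2]; exact Icc_subset_Icc le_rfl h2
  have i2 : IntervalIntegrable g volume (dyadic (k + 1) (2 * n + 1))
      (dyadic (k + 1) (2 * n + 1 + 1)) := by
    refine ContinuousOn.intervalIntegrable (hg.mono ?_)
    rw [uIcc_of_le h2, ← e1, ← e2]; exact Icc_subset_Icc h1 le_rfl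
  unfold avg
  rw [← mul_add, intervalIntegral.integral_add_adjacent_intervals i1 i2, e1, e2]
  ring

lemma cell_subset {a b : ℝ} (hb : 0 ≤ b) {k n : ℕ} (h1 : firstCell a k ≤ n)
    (h2 : n + 1 ≤ endCell b k) : Icc (dyadic k n) (dyadic k (n + 1)) ⊆ Icc a b :=
  Icc_subset_Icc (firstCell_le_iff.1 h1) ((le_endCell_iff hb).1 h2)

lemma avg_mem_image {g : ℝ → ℝ} {a b : ℝ} (hg : ContinuousOn g (Icc a b)) (hb : 0 ≤ b)
    {k n : ℕ} (h1 : firstCell a k ≤ n) (h2 : n + 1 ≤ endCell b k) :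
    avg g k n ∈ g '' Icc a b := by
  have h := cell_subset hb h1 h2
  obtain ⟨c, hc, hgc⟩ := exists_avg_eq (hg.mono h)
  exact ⟨c, h hc, hgc.symm⟩

lemma abs_avg_succ_sub_le {g : ℝ → ℝ} {a b G α : ℝ} (hg : ContinuousOn g (Icc a b)) (hb : 0 ≤ b)
    (hG : 0 ≤ G) (hα : 0 ≤ α) (hα1 : α ≤ 1)
    (hol : ∀ s ∈ Icc a b, ∀ t ∈ Icc a b, |g s - g t| ≤ G * |s - t| ^ α)
    {k n : ℕ} (h1 : firstCell a k ≤ n) (h2 : n + 2 ≤ endCell b k) :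
    |avg g k (n + 1) - avg g k n| ≤ 2 * G * ((1 / 2 : ℝ) ^ k) ^ α := by
  have hs := cell_subset hb h1 (by omega : n + 1 ≤ endCell b k)
  have hs' := cell_subset hb (by omega : firstCell a k ≤ n + 1) (by omega : n + 1 + 1 ≤ endCell b k)
  obtain ⟨c, hc, hgc⟩ := exists_avg_eq (hg.mono hs)
  obtain ⟨c', hc', hgc'⟩ := exists_avg_eq (hg.mono hs')
  have e1 := dyadic_succ_sub k n
  have e2 := dyadic_succ_sub k (n + 1)
  rw [hgc, hgc']
  have hcc : |c' - c| ≤ 2 * (1 / 2 : ℝ) ^ k := by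
    rw [abs_le]; constructor <;> linarith [hc.1, hc.2, hc'.1, hc'.2]
  calc |g c' - g c| ≤ G * |c' - c| ^ α := hol _ (hs' hc') _ (hs hc)
    _ ≤ G * (2 * (1 / 2 : ℝ) ^ k) ^ α := by gcongr
    _ = G * (2 ^ α * ((1 / 2 : ℝ) ^ k) ^ α) := by
        rw [Real.mul_rpow (by norm_num) (by positivity)]
    _ ≤ G * (2 * ((1 / 2 : ℝ) ^ k) ^ α) := by
        gcongr
        calc (2 : ℝ) ^ α ≤ 2 ^ (1 : ℝ) := Real.rpow_le_rpow_of_exponent_le (by norm_num) hα1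
          _ = 2 := by norm_num
    _ = _ := by ring

/-- The part of level `k` in `levyMu`. -/
noncomputable def levyTerm (g : ℝ → ℝ) (a b β : ℝ) (k : ℕ) : ℝ :=
  ((1 / 2 : ℝ) ^ (k + 1)) ^ β * ∑ n ∈ Finset.Ico (firstCell a k) (endCell b k),
    |avg g (k + 1) (2 * n) - avg g (k + 1) (2 * n + 1)|

lemma levyTerm_nonneg (g : ℝ → ℝ) (a b β : ℝ) (k : ℕ) : 0 ≤ levyTerm g a b β k := by
  unfold levyTerm; positivity

lemma levyMu_eq (g : ℝ → ℝ) {a b β : ℝ} (hb0 : 0 ≤ b) (hb1 : b ≤ 1) (k₀ : ℕ) :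
    levyMu g a b β k₀ = ∑' l : ℕ, ENNReal.ofReal (levyTerm g a b β (k₀ + 1 + l)) := by
  unfold levyMu levyTerm
  congr 1
  ext l
  rw [filter_cells_eq hb0 hb1]
  congr 2
  rw [Real.rpow_mul (by norm_num), Real.rpow_neg (by norm_num), Real.rpow_natCast, one_div,
    inv_pow]

lemma sum_levyTerm_le {g : ℝ → ℝ} {a b β m : ℝ} (hb0 : 0 ≤ b) (hb1 : b ≤ 1) (hm0 : 0 ≤ m)
    {k₀ : ℕ} (hm : levyMu g a b β k₀ ≤ ENNReal.ofReal m) (N : ℕ) :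
    ∑ l ∈ Finset.range N, levyTerm g a b β (k₀ + 1 + l) ≤ m := by
  rw [levyMu_eq g hb0 hb1] at hm
  have := (ENNReal.sum_le_tsum (Finset.range N)).trans hm
  rwa [← ENNReal.ofReal_sum_of_nonneg fun _ _ => levyTerm_nonneg _ _ _ _ _,
    ENNReal.ofReal_le_ofReal_iff hm0] at this

/-! ### Comparison of two integrals over polygons -/

lemma abs_integral_sub_integral_le {φ ψ : ℝ → ℝ} (hφ : Continuous φ) (hψ : Continuous ψ)
    {M B S L ω p q p' q' : ℝ} (hp : |p| ≤ M) (hq : |q| ≤ M) (hp' : |p'| ≤ M) (hq' : |q'| ≤ M)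
    (hB : ∀ ξ ∈ uIcc p q, |φ ξ - ψ ξ| ≤ B) (hS : ∀ ξ, |ξ| ≤ M → |ψ ξ| ≤ S) (hL0 : 0 ≤ L)
    (hL : ∀ ξ η, |ξ| ≤ M → |η| ≤ M → |ψ ξ - ψ η| ≤ L * |ξ - η|)
    (hpp : |p - p'| ≤ ω) (hqq : |q - q'| ≤ ω) :
    |(∫ ξ in p..q, φ ξ) - ∫ ξ in p'..q', ψ ξ| ≤
      (B + L * ω) * |q - p| + S * |(q - p) - (q' - p')| := by
  have hseg : ∀ {u v r : ℝ}, |u| ≤ M → |v| ≤ M → r ∈ Icc (0 : ℝ) 1 →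
      |u + (v - u) * r| ≤ M := by
    intro u v r hu hv hr
    have h1 : u + (v - u) * r = (1 - r) * u + r * v := by ring
    rw [h1]
    calc |(1 - r) * u + r * v| ≤ |(1 - r) * u| + |r * v| := abs_add_le _ _
      _ = (1 - r) * |u| + r * |v| := by
          rw [abs_mul, abs_mul, abs_of_nonneg hr.1, abs_of_nonneg (sub_nonneg.2 hr.2)]
      _ ≤ (1 - r) * M + r * M := by
          have := hr.1; have := sub_nonneg.2 hr.2; gcongr
      _ = M := by ring
  have hsub : ∀ u v : ℝ, ∫ ξ in u..v, ψ ξ = ∫ r in (0 : ℝ)..1, (v - u) * ψ (u + (v - u) * r) := by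
    intro u v
    rw [intervalIntegral.integral_const_mul, intervalIntegral.mul_integral_comp_add_mul]
    simp
  have h1 : |(∫ ξ in p..q, φ ξ) - ∫ ξ in p..q, ψ ξ| ≤ B * |q - p| := by
    rw [← intervalIntegral.integral_sub (hφ.intervalIntegrable _ _) (hψ.intervalIntegrable _ _)]
    exact intervalIntegral.norm_integral_le_of_norm_le_const (f := fun ξ => φ ξ - ψ ξ)
      fun ξ hξ => hB ξ (uIoc_subset_uIcc hξ)
  have h2 : |(∫ ξ in p..q, ψ ξ) - ∫ ξ in p'..q', ψ ξ| ≤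
      L * ω * |q - p| + S * |(q - p) - (q' - p')| := by
    rw [hsub, hsub, ← intervalIntegral.integral_sub
      (Continuous.intervalIntegrable (by fun_prop) _ _)
      (Continuous.intervalIntegrable (by fun_prop) _ _)]
    have := intervalIntegral.norm_integral_le_of_norm_le_const (a := (0 : ℝ)) (b := 1)
      (f := fun r => (q - p) * ψ (p + (q - p) * r) - (q' - p') * ψ (p' + (q' - p') * r))
      (C := L * ω * |q - p| + S * |(q - p) - (q' - p')|) ?_
    · simpa using this
    intro r hr
    rw [uIoc_of_le zero_le_one] at hr
    have hr' : r ∈ Icc (0 : ℝ) 1 := ⟨hr.1.le, hr.2⟩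
    have e : (q - p) * ψ (p + (q - p) * r) - (q' - p') * ψ (p' + (q' - p') * r) =
        (q - p) * (ψ (p + (q - p) * r) - ψ (p' + (q' - p') * r))
          + ((q - p) - (q' - p')) * ψ (p' + (q' - p') * r) := by ring
    have hd : |p + (q - p) * r - (p' + (q' - p') * r)| ≤ ω := by
      have h1 : p + (q - p) * r - (p' + (q' - p') * r)
          = (1 - r) * (p - p') + r * (q - q') := by ring
      rw [h1]
      calc |(1 - r) * (p - p') + r * (q - q')| ≤ |(1 - r) * (p - p')| + |r * (q - q')| :=
            abs_add_le _ _
        _ = (1 - r) * |p - p'| + r * |q - q'| := by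
            rw [abs_mul, abs_mul, abs_of_nonneg hr'.1, abs_of_nonneg (sub_nonneg.2 hr'.2)]
        _ ≤ (1 - r) * ω + r * ω := by
            have := hr'.1; have := sub_nonneg.2 hr'.2; gcongr
        _ = ω := by ring
    rw [e, Real.norm_eq_abs]
    refine (abs_add_le _ _).trans ?_
    rw [abs_mul, abs_mul]
    have h3 := (hL _ _ (hseg hp hq hr') (hseg hp' hq' hr')).trans
      (mul_le_mul_of_nonneg_left hd hL0)
    have h4 := hS _ (hseg hp' hq' hr')
    have h5 := mul_le_mul_of_nonneg_left h3 (abs_nonneg (q - p))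
    have h6 := mul_le_mul_of_nonneg_left h4 (abs_nonneg ((q - p) - (q' - p')))
    linarith
  calc _ ≤ _ := abs_sub_le _ (∫ ξ in p..q, ψ ξ) _
    _ ≤ _ := add_le_add h1 h2
    _ = _ := by ring

/-- The constant of the boundary terms: four for the edges of the coarsest polygon, and four times
the sum of the geometric series of ratio `2^{-α}` for the two ends of all finer ones. -/
noncomputable def geomConst (α : ℝ) : ℝ := 4 + 4 / (1 - (1 / 2 : ℝ) ^ α)

lemma half_rpow_lt_one {α : ℝ} (hα : 0 < α) : (1 / 2 : ℝ) ^ α < 1 :=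
  Real.rpow_lt_one (by norm_num) (by norm_num) hα

lemma geomConst_nonneg {α : ℝ} (hα : 0 < α) : 0 ≤ geomConst α := by
  have := sub_pos.2 (half_rpow_lt_one hα)
  unfold geomConst; positivity

lemma sum_half_pow_rpow_le {α : ℝ} (hα : 0 < α) (k N : ℕ) :
    ∑ l ∈ Finset.range N, ((1 / 2 : ℝ) ^ (k + l)) ^ α ≤
      ((1 / 2 : ℝ) ^ k) ^ α / (1 - (1 / 2 : ℝ) ^ α) := by
  have h1 := half_rpow_lt_one hα
  have h0 : (0 : ℝ) ≤ (1 / 2 : ℝ) ^ α := by positivity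
  have e : ∀ l : ℕ, ((1 / 2 : ℝ) ^ (k + l)) ^ α = ((1 / 2 : ℝ) ^ k) ^ α * ((1 / 2 : ℝ) ^ α) ^ l := by
    intro l
    rw [pow_add, Real.mul_rpow (by positivity) (by positivity), ← Real.rpow_natCast_mul (by norm_num),
      ← Real.rpow_natCast_mul (by norm_num), ← Real.rpow_mul_natCast (by norm_num), mul_comm α]
  simp_rw [e]
  rw [← Finset.mul_sum]
  refine (mul_le_mul_of_nonneg_left ?_ (by positivity)).trans_eq (div_eq_mul_inv _ _).symm
  rw [← tsum_geometric_of_lt_one h0 h1]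
  exact (summable_geometric_of_lt_one h0 h1).sum_le_tsum _ fun _ _ => by positivity

/-- The integral over a polygon edge as the increment of a potential, for a pair of integrands
and of paths. -/
noncomputable def pairPotential (f f' : ℝ → ℝ → ℝ) (t : ℝ) (P : ℝ × ℝ) : ℝ :=
  (∫ ξ in (0 : ℝ)..P.1, f t ξ) - ∫ ξ in (0 : ℝ)..P.2, f' t ξ

lemma pairPotential_sub {f f' : ℝ → ℝ → ℝ} {t : ℝ} (hf : Continuous (f t))
    (hf' : Continuous (f' t)) (P Q : ℝ × ℝ) :
    pairPotential f f' t Q - pairPotential f f' t P =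
      (∫ ξ in P.1..Q.1, f t ξ) - ∫ ξ in P.2..Q.2, f' t ξ := by
  unfold pairPotential
  rw [← intervalIntegral.integral_interval_sub_left (hf.intervalIntegrable 0 Q.1)
      (hf.intervalIntegrable 0 P.1),
    ← intervalIntegral.integral_interval_sub_left (hf'.intervalIntegrable 0 Q.2)
      (hf'.intervalIntegrable 0 P.2)]
  ring

lemma edgeSum_pairPotential {f f' : ℝ → ℝ → ℝ} {g g' : ℝ → ℝ} {a b : ℝ} (hb0 : 0 ≤ b)
    (hb1 : b ≤ 1) (hf : ∀ t ∈ Icc a b, Continuous (f t)) (hf' : ∀ t ∈ Icc a b, Continuous (f' t))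
    (k : ℕ) :
    edgeSum (pairPotential f f') (fun k n => (avg g k n, avg g' k n)) a b (k + 1) =
      polygonIntegral f g a b (k + 1) - polygonIntegral f' g' a b (k + 1) := by
  unfold edgeSum polygonIntegral
  rw [← Finset.sum_sub_distrib]
  refine Finset.sum_congr rfl fun n hn => ?_
  rw [cells_succ_edges hb0 hb1, Finset.mem_Ico] at hn
  have h1 := (firstCell_succ a k).1
  have h2 := (endCell_succ hb0 k).1
  have ht : dyadic (k + 1) (n + 1) ∈ Icc a b :=
    cell_subset hb0 (by omega : firstCell a (k + 1) ≤ n) (by omega)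
      (right_mem_Icc.2 (dyadic_lt_succ _ _).le)
  exact pairPotential_sub (hf _ ht) (hf' _ ht) _ _

lemma dyadic_mid (k n : ℕ) :
    dyadic (k + 1) (2 * n + 1) - dyadic k n = (1 / 2 : ℝ) ^ (k + 1) ∧
      dyadic k (n + 1) - dyadic (k + 1) (2 * n + 1) = (1 / 2 : ℝ) ^ (k + 1) := by
  have h1 := dyadic_succ_sub (k + 1) (2 * n)
  have h2 := dyadic_succ_sub (k + 1) (2 * n + 1)
  rw [dyadic_succ_two_mul] at h1
  rw [show 2 * n + 1 + 1 = 2 * (n + 1) by ring, dyadic_succ_two_mul] at h2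
  exact ⟨h1, h2⟩

/-- The stability estimate for the integral on a short interval. The difference `f - f'` of the
integrands is measured in `H_{β₀}`; the difference `g' - g` of the paths is weighted with the
`H_β` size `H` of `f'`, and with the size `Hx` of its mixed increments in time and space. -/
theorem abs_pathIntegral_sub_le {f f' : ℝ → ℝ → ℝ} {g g' : ℝ → ℝ}
    {a b α β β₀ M A B H Hx S L G G' ω m m' I I' : ℝ} {k₀ : ℕ}
    (ha : 0 ≤ a) (hab : a < b) (hb1 : b ≤ 1) (hα : 0 < α) (hα1 : α ≤ 1)
    (hk₁ : (1 / 2 : ℝ) ^ (k₀ + 1) ≤ b - a) (hk₂ : b - a ≤ 2 * (1 / 2 : ℝ) ^ k₀)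
    (hA0 : 0 ≤ A) (hB0 : 0 ≤ B) (hH0 : 0 ≤ H) (hHx0 : 0 ≤ Hx) (hS0 : 0 ≤ S) (hL0 : 0 ≤ L)
    (hG0 : 0 ≤ G) (hG'0 : 0 ≤ G') (hω0 : 0 ≤ ω) (hm0 : 0 ≤ m) (hm'0 : 0 ≤ m')
    (hf : ∀ t ∈ Icc a b, Continuous (f t)) (hf' : ∀ t ∈ Icc a b, Continuous (f' t))
    (hg : ContinuousOn g (Icc a b)) (hg' : ContinuousOn g' (Icc a b))
    (hgM : ∀ t ∈ Icc a b, |g t| ≤ M) (hg'M : ∀ t ∈ Icc a b, |g' t| ≤ M)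
    (hgG : ∀ s ∈ Icc a b, ∀ t ∈ Icc a b, |g s - g t| ≤ G * |s - t| ^ α)
    (hgG' : ∀ s ∈ Icc a b, ∀ t ∈ Icc a b, |(g s - g' s) - (g t - g' t)| ≤ G' * |s - t| ^ α)
    (hω : ∀ t ∈ Icc a b, |g t - g' t| ≤ ω)
    (hA : ∀ s ∈ Icc a b, ∀ t ∈ Icc a b, ∀ ξ ∈ g '' Icc a b,
      |(f s ξ - f' s ξ) - (f t ξ - f' t ξ)| ≤ A * |s - t| ^ β₀)
    (hB : ∀ t ∈ Icc a b, ∀ ξ ∈ g '' Icc a b, |f t ξ - f' t ξ| ≤ B)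
    (hH : ∀ s ∈ Icc a b, ∀ t ∈ Icc a b, ∀ ξ, |ξ| ≤ M → |f' s ξ - f' t ξ| ≤ H * |s - t| ^ β)
    (hS : ∀ t ∈ Icc a b, ∀ ξ, |ξ| ≤ M → |f' t ξ| ≤ S)
    (hHx : ∀ s ∈ Icc a b, ∀ t ∈ Icc a b, ∀ ξ η, |ξ| ≤ M → |η| ≤ M →
      |(f' s ξ - f' t ξ) - (f' s η - f' t η)| ≤ Hx * |s - t| ^ β₀ * |ξ - η|)
    (hL : ∀ t ∈ Icc a b, ∀ ξ η, |ξ| ≤ M → |η| ≤ M → |f' t ξ - f' t η| ≤ L * |ξ - η|)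
    (hm : levyMu g a b β₀ k₀ ≤ ENNReal.ofReal m)
    (hm' : levyMu (fun t => g' t - g t) a b β k₀ ≤ ENNReal.ofReal m')
    (hI : HasPathIntegral f g a b I) (hI' : HasPathIntegral f' g' a b I') :
    |I - I'| ≤ (A + Hx * ω) * m + H * m'
      + geomConst α * (2 * ((B + L * ω) * G + S * G')) * (b - a) ^ α := by
  have hb0 : 0 ≤ b := ha.trans hab.le
  set v : ℕ → ℕ → ℝ × ℝ := fun k n => (avg g k n, avg g' k n) with hv
  set Ψ := pairPotential f f' with hΨ
  set R := 2 * ((B + L * ω) * G + S * G') with hR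
  have hR0 : 0 ≤ R := by positivity
  set τ : ℕ → ℝ := fun k => (1 / 2 : ℝ) ^ k with hτ
  have hτ0 : ∀ k, 0 ≤ τ k := fun k => by positivity
  -- by the mean value theorem the vertices are values of `g` and `g'` on `[a, b]`
  have hvert : ∀ k n, firstCell a k ≤ n → n + 1 ≤ endCell b k →
      ((v k n).1 ∈ g '' Icc a b ∧ |(v k n).1| ≤ M) ∧ |(v k n).2| ≤ M
        ∧ |(v k n).1 - (v k n).2| ≤ ω := by
    intro k n h1 h2
    have hs := cell_subset hb0 h1 h2
    have i1 := avg_mem_image hg hb0 h1 h2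
    have i2 := avg_mem_image hg' hb0 h1 h2
    have i3 := avg_mem_image (hg.sub hg') hb0 h1 h2
    have e : avg (g - g') k n = avg g k n - avg g' k n := avg_sub (hg.mono hs) (hg'.mono hs)
    refine ⟨⟨i1, ?_⟩, ?_, ?_⟩
    · obtain ⟨c, hc, h⟩ := i1; simp only [hv]; rw [← h]; exact hgM c hc
    · obtain ⟨c, hc, h⟩ := i2; simp only [hv]; rw [← h]; exact hg'M c hc
    · obtain ⟨c, hc, h⟩ := i3; simp only [hv]; rw [← e, ← h]; exact hω c hc
  have hseg : ∀ P Q : ℝ × ℝ, P.1 ∈ g '' Icc a b → Q.1 ∈ g '' Icc a b →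
      uIcc P.1 Q.1 ⊆ g '' Icc a b := fun P Q hP hQ =>
    ((isPreconnected_Icc.image g hg).ordConnected).uIcc_subset hP hQ
  -- increments in space at a fixed time, which will be used for the ends of the polygons, and
  -- mixed increments in time and space, which will be summed over all edges
  have hspace : ∀ t ∈ Icc a b, ∀ k n k' n', firstCell a k ≤ n → n + 1 ≤ endCell b k →
      firstCell a k' ≤ n' → n' + 1 ≤ endCell b k' →
      |Ψ t (v k' n') - Ψ t (v k n)| ≤ (B + L * ω) * |(v k' n').1 - (v k n).1|
        + S * |((v k' n').1 - (v k n).1) - ((v k' n').2 - (v k n).2)| := by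
    intro t ht k n k' n' h1 h2 h3 h4
    obtain ⟨⟨p1, p2⟩, p3, p4⟩ := hvert k n h1 h2
    obtain ⟨⟨q1, q2⟩, q3, q4⟩ := hvert k' n' h3 h4
    rw [hΨ, pairPotential_sub (hf t ht) (hf' t ht)]
    exact abs_integral_sub_integral_le (hf t ht) (hf' t ht) p2 q2 p3 q3
      (fun ξ hξ => hB t ht ξ (hseg _ _ p1 q1 hξ)) (hS t ht) hL0 (hL t ht) p4 q4
  have htime : ∀ s ∈ Icc a b, ∀ t ∈ Icc a b, ∀ k n k' n', firstCell a k ≤ n →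
      n + 1 ≤ endCell b k → firstCell a k' ≤ n' → n' + 1 ≤ endCell b k' →
      |(Ψ s (v k' n') - Ψ s (v k n)) - (Ψ t (v k' n') - Ψ t (v k n))| ≤
        (A + Hx * ω) * |s - t| ^ β₀ * |(v k' n').1 - (v k n).1|
        + H * |s - t| ^ β * |((v k' n').1 - (v k n).1) - ((v k' n').2 - (v k n).2)| := by
    intro s hs t ht k n k' n' h1 h2 h3 h4
    obtain ⟨⟨p1, p2⟩, p3, p4⟩ := hvert k n h1 h2
    obtain ⟨⟨q1, q2⟩, q3, q4⟩ := hvert k' n' h3 h4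
    have hfs := hf s hs
    have hft := hf t ht
    have hfs' := hf' s hs
    have hft' := hf' t ht
    rw [hΨ, pairPotential_sub hfs hfs', pairPotential_sub hft hft']
    have h := abs_integral_sub_integral_le (φ := fun ξ => f s ξ - f t ξ)
      (ψ := fun ξ => f' s ξ - f' t ξ) (hfs.sub hft) (hfs'.sub hft')
      p2 q2 p3 q3 (B := A * |s - t| ^ β₀) (S := H * |s - t| ^ β) (L := Hx * |s - t| ^ β₀)
      (fun ξ hξ => by
        have := hA s hs t ht ξ (hseg _ _ p1 q1 hξ)
        rwa [show f s ξ - f t ξ - (f' s ξ - f' t ξ) = f s ξ - f' s ξ - (f t ξ - f' t ξ) by ring])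
      (hH s hs t ht) (by positivity) (hHx s hs t ht) p4 q4
    rw [intervalIntegral.integral_sub (hfs.intervalIntegrable _ _) (hft.intervalIntegrable _ _),
      intervalIntegral.integral_sub (hfs'.intervalIntegrable _ _) (hft'.intervalIntegrable _ _)]
      at h
    calc _ = _ := by congr 1; ring
      _ ≤ _ := h
      _ = _ := by ring
  have hρ0 : ∀ k, 0 ≤ R * τ k ^ α := fun k => by have := hτ0 k; positivity
  -- a full edge has length `O(2^{-kα})`, for `g` and for `g - g'`
  have hdg : ∀ k n, firstCell a k ≤ n → n + 2 ≤ endCell b k →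
      |(v k (n + 1)).1 - (v k n).1| ≤ 2 * G * τ k ^ α := fun k n h1 h2 =>
    abs_avg_succ_sub_le hg hb0 hG0 hα.le hα1 hgG h1 h2
  have hdgg : ∀ k n, firstCell a k ≤ n → n + 2 ≤ endCell b k →
      |((v k (n + 1)).1 - (v k n).1) - ((v k (n + 1)).2 - (v k n).2)| ≤ 2 * G' * τ k ^ α := by
    intro k n h1 h2
    have h := abs_avg_succ_sub_le (hg.sub hg') hb0 hG'0 hα.le hα1 hgG' h1 h2
    have s1 := cell_subset hb0 h1 (by omega : n + 1 ≤ endCell b k)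
    have s2 := cell_subset hb0 (by omega : firstCell a k ≤ n + 1)
      (by omega : n + 1 + 1 ≤ endCell b k)
    have e1 : avg (g - g') k n = avg g k n - avg g' k n := avg_sub (hg.mono s1) (hg'.mono s1)
    have e2 : avg (g - g') k (n + 1) = avg g k (n + 1) - avg g' k (n + 1) :=
      avg_sub (hg.mono s2) (hg'.mono s2)
    rw [e1, e2] at h
    rwa [show ∀ x y z w : ℝ, (x - y) - (z - w) = (x - z) - (y - w) by intros; ring] at h
  have h_edge : ∀ k n, firstCell a k ≤ n → n + 2 ≤ endCell b k →
      |Ψ (dyadic k (n + 1)) (v k (n + 1)) - Ψ (dyadic k (n + 1)) (v k n)| ≤ R * τ k ^ α := by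
    intro k n h1 h2
    have ht : dyadic k (n + 1) ∈ Icc a b :=
      cell_subset hb0 h1 (by omega) (right_mem_Icc.2 (dyadic_lt_succ _ _).le)
    refine (hspace _ ht k n k (n + 1) h1 (by omega) (by omega) (by omega)).trans ?_
    have hBL : 0 ≤ B + L * ω := by positivity
    have := mul_le_mul_of_nonneg_left (hdg k n h1 h2) hBL
    have := mul_le_mul_of_nonneg_left (hdgg k n h1 h2) hS0
    have e : R * τ k ^ α = (B + L * ω) * (2 * G * τ k ^ α) + S * (2 * G' * τ k ^ α) := by
      rw [hR]; ring
    linarith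
  -- a vertex of level `k` is the midpoint of an edge of level `k + 1`
  have hhalf : ∀ k n, firstCell a k ≤ n → n + 1 ≤ endCell b k →
      (firstCell a (k + 1) ≤ 2 * n ∧ 2 * n + 2 ≤ endCell b (k + 1)) ∧
      (v k n = ((v (k + 1) (2 * n)).1 / 2 + (v (k + 1) (2 * n + 1)).1 / 2,
        (v (k + 1) (2 * n)).2 / 2 + (v (k + 1) (2 * n + 1)).2 / 2)) ∧
      (dyadic k n ∈ Icc a b ∧ dyadic k (n + 1) ∈ Icc a b
        ∧ dyadic (k + 1) (2 * n + 1) ∈ Icc a b) := by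
    intro k n h1 h2
    have hp := (firstCell_succ a k).1
    have hq := (endCell_succ hb0 k).1
    have hs := cell_subset hb0 h1 h2
    refine ⟨⟨by omega, by omega⟩, ?_, hs (left_mem_Icc.2 (dyadic_lt_succ _ _).le),
      hs (right_mem_Icc.2 (dyadic_lt_succ _ _).le), hs ?_⟩
    · simp only [hv]
      rw [avg_eq_half (hg.mono hs), avg_eq_half (hg'.mono hs)]
      ext <;> simp <;> ring
    · obtain ⟨e1, e2⟩ := dyadic_mid k n
      have : (0 : ℝ) < (1 / 2) ^ (k + 1) := by positivity
      exact ⟨by linarith, by linarith⟩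
  have hhalf_r : ∀ k n, firstCell a k ≤ n → n + 1 ≤ endCell b k →
      ((v (k + 1) (2 * n + 1)).1 - (v k n).1
        = ((v (k + 1) (2 * n + 1)).1 - (v (k + 1) (2 * n)).1) / 2) ∧
      (((v (k + 1) (2 * n + 1)).1 - (v k n).1) - ((v (k + 1) (2 * n + 1)).2 - (v k n).2)
        = (((v (k + 1) (2 * n + 1)).1 - (v (k + 1) (2 * n)).1)
          - ((v (k + 1) (2 * n + 1)).2 - (v (k + 1) (2 * n)).2)) / 2) := by
    intro k n h1 h2
    rw [(hhalf k n h1 h2).2.1]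
    constructor <;> ring
  have hhalf_l : ∀ k n, firstCell a k ≤ n → n + 1 ≤ endCell b k →
      ((v k n).1 - (v (k + 1) (2 * n)).1
        = ((v (k + 1) (2 * n + 1)).1 - (v (k + 1) (2 * n)).1) / 2) ∧
      (((v k n).1 - (v (k + 1) (2 * n)).1) - ((v k n).2 - (v (k + 1) (2 * n)).2)
        = (((v (k + 1) (2 * n + 1)).1 - (v (k + 1) (2 * n)).1)
          - ((v (k + 1) (2 * n + 1)).2 - (v (k + 1) (2 * n)).2)) / 2) := by
    intro k n h1 h2
    rw [(hhalf k n h1 h2).2.1]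
    constructor <;> ring
  have hhalf_bound : ∀ k n, firstCell a k ≤ n → n + 1 ≤ endCell b k →
      (B + L * ω) * |((v (k + 1) (2 * n + 1)).1 - (v (k + 1) (2 * n)).1) / 2|
        + S * |(((v (k + 1) (2 * n + 1)).1 - (v (k + 1) (2 * n)).1)
          - ((v (k + 1) (2 * n + 1)).2 - (v (k + 1) (2 * n)).2)) / 2| ≤ R * τ (k + 1) ^ α := by
    intro k n h1 h2
    obtain ⟨i1, i2⟩ := (hhalf k n h1 h2).1
    have hBL : 0 ≤ B + L * ω := by positivity
    rw [abs_div, abs_div, abs_two]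
    have h3 := mul_le_mul_of_nonneg_left (hdg (k + 1) (2 * n) i1 i2) hBL
    have h4 := mul_le_mul_of_nonneg_left (hdgg (k + 1) (2 * n) i1 i2) hS0
    have e : R * τ (k + 1) ^ α
        = (B + L * ω) * (2 * G * τ (k + 1) ^ α) + S * (2 * G' * τ (k + 1) ^ α) := by
      rw [hR]; ring
    have := hρ0 (k + 1)
    linarith
  set ε : ℕ → ℕ → ℝ := fun k n =>
    (A + Hx * ω) * τ (k + 1) ^ β₀ * (|avg g (k + 1) (2 * n) - avg g (k + 1) (2 * n + 1)| / 2)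
      + H * τ (k + 1) ^ β * (|avg (fun t => g' t - g t) (k + 1) (2 * n)
        - avg (fun t => g' t - g t) (k + 1) (2 * n + 1)| / 2) with hε
  have hε_eq : ∀ k n, firstCell a k ≤ n → n + 1 ≤ endCell b k →
      (A + Hx * ω) * τ (k + 1) ^ β₀
          * |((v (k + 1) (2 * n + 1)).1 - (v (k + 1) (2 * n)).1) / 2|
        + H * τ (k + 1) ^ β * |(((v (k + 1) (2 * n + 1)).1 - (v (k + 1) (2 * n)).1)
          - ((v (k + 1) (2 * n + 1)).2 - (v (k + 1) (2 * n)).2)) / 2| = ε k n := by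
    intro k n h1 h2
    obtain ⟨i1, i2⟩ := (hhalf k n h1 h2).1
    have s1 := cell_subset hb0 i1 (by omega : 2 * n + 1 ≤ endCell b (k + 1))
    have s2 := cell_subset hb0 (by omega : firstCell a (k + 1) ≤ 2 * n + 1)
      (by omega : 2 * n + 1 + 1 ≤ endCell b (k + 1))
    simp only [hε, hv]
    rw [avg_sub (hg'.mono s1) (hg.mono s1), avg_sub (hg'.mono s2) (hg.mono s2), abs_div, abs_div,
      abs_two, abs_sub_comm (avg g (k + 1) (2 * n + 1))]
    congr 4
    ring
  have hstep := abs_edgeSum_succ_sub_le Ψ v hb0 hb1 (fun k => R * τ k ^ α) ε hρ0 h_edge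
    (fun k n h1 h2 => by
      obtain ⟨⟨i1, i2⟩, -, -, -, ht⟩ := hhalf k n h1 h2
      have h := hspace _ ht k n (k + 1) (2 * n + 1) h1 h2 (by omega) (by omega)
      rw [(hhalf_r k n h1 h2).2, (hhalf_r k n h1 h2).1] at h
      exact h.trans (hhalf_bound k n h1 h2))
    (fun k n h1 h2 => by
      obtain ⟨⟨i1, i2⟩, -, -, -, ht⟩ := hhalf k n h1 h2
      have h := hspace _ ht (k + 1) (2 * n) k n i1 (by omega) h1 h2
      rw [(hhalf_l k n h1 h2).2, (hhalf_l k n h1 h2).1] at h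
      exact h.trans (hhalf_bound k n h1 h2))
    (fun k n h1 h2 => by
      obtain ⟨⟨i1, i2⟩, -, -, ht', ht⟩ := hhalf k n h1 h2
      have h := htime _ ht _ ht' k n (k + 1) (2 * n + 1) h1 h2 (by omega) (by omega)
      rw [(hhalf_r k n h1 h2).2, (hhalf_r k n h1 h2).1, abs_sub_comm (dyadic _ _),
        (dyadic_mid k n).2, abs_of_pos (by positivity : (0 : ℝ) < (1 / 2) ^ (k + 1))] at h
      exact h.trans (hε_eq k n h1 h2).le)
    (fun k n h1 h2 => by
      obtain ⟨⟨i1, i2⟩, -, ht', -, ht⟩ := hhalf k n h1 h2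
      have h := htime _ ht _ ht' (k + 1) (2 * n) k n i1 (by omega) h1 h2
      rw [(hhalf_l k n h1 h2).2, (hhalf_l k n h1 h2).1,
        (dyadic_mid k n).1, abs_of_pos (by positivity : (0 : ℝ) < (1 / 2) ^ (k + 1))] at h
      exact h.trans (hε_eq k n h1 h2).le)
  have hfirst := abs_edgeSum_first_le Ψ v hb0 hb1 hab.le hk₂ (hρ0 (k₀ + 1)) (h_edge (k₀ + 1))
  -- summed over the levels, `ε` gives `levyMu` and `ρ` gives a geometric series
  have hτmono : ∀ k, τ (k + 1) ^ α ≤ τ k ^ α := fun k => by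
    simp only [hτ]; gcongr ?_ ^ α
    exact pow_le_pow_of_le_one (by norm_num) (by norm_num) (by omega)
  have hε_sum : ∀ k, 2 * ∑ n ∈ Finset.Ico (firstCell a k) (endCell b k), ε k n =
      (A + Hx * ω) * levyTerm g a b β₀ k + H * levyTerm (fun t => g' t - g t) a b β k := by
    intro k
    simp only [hε, levyTerm, hτ, Finset.sum_add_distrib, mul_add, Finset.mul_sum]
    congr 1 <;> exact Finset.sum_congr rfl fun n _ => by ring
  have hstep' : ∀ l, |edgeSum Ψ v a b (k₀ + 1 + (l + 1)) - edgeSum Ψ v a b (k₀ + 1 + l)| ≤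
      (A + Hx * ω) * levyTerm g a b β₀ (k₀ + 1 + l)
        + H * levyTerm (fun t => g' t - g t) a b β (k₀ + 1 + l)
        + 4 * R * τ (k₀ + 1 + l) ^ α := by
    intro l
    have h := hstep (k₀ + l)
    rw [show k₀ + l + 2 = k₀ + 1 + (l + 1) by ring, show k₀ + l + 1 = k₀ + 1 + l by ring,
      hε_sum] at h
    refine h.trans ?_
    have := mul_le_mul_of_nonneg_left (hτmono (k₀ + 1 + l)) hR0
    rw [show k₀ + 1 + (l + 1) = k₀ + 1 + l + 1 by ring]
    linarith
  have htel : ∀ N, |edgeSum Ψ v a b (k₀ + 1 + N)| ≤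
      ∑ l ∈ Finset.range N, ((A + Hx * ω) * levyTerm g a b β₀ (k₀ + 1 + l)
        + H * levyTerm (fun t => g' t - g t) a b β (k₀ + 1 + l)
        + 4 * R * τ (k₀ + 1 + l) ^ α) + 4 * (R * τ (k₀ + 1) ^ α) := by
    intro N
    induction N with
    | zero => simpa using hfirst
    | succ N ih =>
      rw [Finset.sum_range_succ]
      have h1 := hstep' N
      have h2 := abs_sub_abs_le_abs_sub (edgeSum Ψ v a b (k₀ + 1 + (N + 1)))
        (edgeSum Ψ v a b (k₀ + 1 + N))
      linarith
  have hbound : ∀ N, |edgeSum Ψ v a b (k₀ + 1 + N)| ≤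
      (A + Hx * ω) * m + H * m' + geomConst α * R * (b - a) ^ α := by
    intro N
    refine (htel N).trans ?_
    rw [Finset.sum_add_distrib, Finset.sum_add_distrib, ← Finset.mul_sum, ← Finset.mul_sum,
      ← Finset.mul_sum]
    have h1 := mul_le_mul_of_nonneg_left (sum_levyTerm_le hb0 hb1 hm0 hm N)
      (by positivity : 0 ≤ A + Hx * ω)
    have h2 := mul_le_mul_of_nonneg_left (sum_levyTerm_le hb0 hb1 hm'0 hm' N) hH0
    have h3 := mul_le_mul_of_nonneg_left (sum_half_pow_rpow_le hα (k₀ + 1) N)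
      (by positivity : 0 ≤ 4 * R)
    have h4 : geomConst α * R * τ (k₀ + 1) ^ α ≤ geomConst α * R * (b - a) ^ α := by
      have := geomConst_nonneg hα
      have := hτ0 (k₀ + 1)
      gcongr
    have h5 : geomConst α * R * τ (k₀ + 1) ^ α
        = 4 * R * (τ (k₀ + 1) ^ α / (1 - (1 / 2 : ℝ) ^ α)) + 4 * (R * τ (k₀ + 1) ^ α) := by
      unfold geomConst; ring
    linarith
  have hlim : Tendsto (fun N => edgeSum Ψ v a b (k₀ + 1 + N)) atTop (𝓝 (I - I')) := by
    have h := (hI.sub hI').comp (tendsto_add_atTop_nat (k₀ + 1))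
    refine h.congr fun N => ?_
    rw [show k₀ + 1 + N = k₀ + N + 1 by ring, hΨ, hv, edgeSum_pairPotential hb0 hb1 hf hf']
    simp only [Function.comp_apply]
    rw [show N + (k₀ + 1) = k₀ + N + 1 by ring]
  exact le_of_tendsto hlim.abs (Eventually.of_forall hbound)

/-- The integral is additive in the interval: at each level at most three edges are not
accounted for, and their contributions tend to zero. -/
lemma HasPathIntegral.sub_left {f : ℝ → ℝ → ℝ} {g : ℝ → ℝ} {a b I J : ℝ}
    (ha : 0 ≤ a) (hab : a ≤ b) (hb1 : b ≤ 1) {ρ : ℕ → ℝ} (hρ : Tendsto ρ atTop (𝓝 0))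
    (hρ0 : ∀ k, 0 ≤ ρ k)
    (h_edge : ∀ k n, n + 2 ≤ endCell b k →
      |∫ ξ in avg g k n..avg g k (n + 1), f (dyadic k (n + 1)) ξ| ≤ ρ k)
    (hI : HasPathIntegral f g 0 a I) (hJ : HasPathIntegral f g 0 b J) :
    HasPathIntegral f g a b (J - I) := by
  have hb0 := ha.trans hab
  have ha1 := hab.trans hb1
  have hd : Tendsto (fun k => (polygonIntegral f g 0 b (k + 1) - polygonIntegral f g 0 a (k + 1))
      - polygonIntegral f g a b (k + 1)) atTop (𝓝 0) := by
    refine squeeze_zero_norm (a := fun k => 3 * ρ (k + 1)) (fun k => ?_) ?_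
    · unfold polygonIntegral
      rw [cells_succ_edges hb0 hb1, cells_succ_edges ha ha1, cells_succ_edges hb0 hb1]
      have h0 : firstCell 0 k = 0 := by simp [firstCell]
      have h1 : endCell a k ≤ firstCell a k := Nat.floor_le_ceil _
      have h2 : firstCell a k ≤ endCell a k + 1 := Nat.ceil_le_floor_add_one _
      have h3 : endCell a k ≤ endCell b k := by unfold endCell; gcongr
      have h4 := endCell_succ hb0 k
      rw [h0, mul_zero, ← Finset.sum_Ico_consecutive _ (Nat.zero_le (2 * endCell a k - 1))
          (by omega : 2 * endCell a k - 1 ≤ 2 * endCell b k - 1), add_sub_cancel_left]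
      refine (abs_sum_sub_sum_le
        (u := Finset.Ico (2 * endCell a k - 1) (2 * endCell a k - 1 + 3)) ?_ ?_ (hρ0 (k + 1))
        ?_).trans ?_
      · intro n; simp only [Finset.mem_Ico]; omega
      · intro n; simp only [Finset.mem_Ico, Finset.mem_sdiff]; omega
      · intro n hn
        rw [Finset.mem_Ico] at hn
        exact h_edge (k + 1) n (by omega)
      · simp
    · simpa using (hρ.comp (tendsto_add_atTop_nat 1)).const_mul 3
  have h1 := (hJ.sub hI).comp (tendsto_add_atTop_nat 1)
  have h2 := h1.sub hd
  rw [sub_zero] at h2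
  refine (tendsto_add_atTop_iff_nat 1).1 (h2.congr fun k => ?_)
  simp

/-! ### Hölder continuity on an interval -/

section Holder

variable {V : Type*} [NormedAddCommGroup V]

/-- `f` is Hölder continuous on `[a, b]` with exponent `β` and constant `C`. -/
def HolderOn (β C a b : ℝ) (f : ℝ → V) : Prop :=
  ∀ s ∈ Icc a b, ∀ t ∈ Icc a b, ‖f s - f t‖ ≤ C * |s - t| ^ β

lemma HolderOn.mono {β C a b a' b' : ℝ} {f : ℝ → V} (h : HolderOn β C a b f) (ha : a ≤ a')
    (hb : b' ≤ b) : HolderOn β C a' b' f := fun s hs t ht =>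
  h s (Icc_subset_Icc ha hb hs) t (Icc_subset_Icc ha hb ht)

lemma HolderOn.continuousOn {β C a b : ℝ} {f : ℝ → V} (h : HolderOn β C a b f) (hβ : 0 < β) :
    ContinuousOn f (Icc a b) := by
  intro t ht
  refine tendsto_iff_norm_sub_tendsto_zero.2 (squeeze_zero' (Eventually.of_forall fun _ =>
    norm_nonneg _) (eventually_nhdsWithin_of_forall fun s hs => h s hs t ht) ?_)
  have : Continuous fun s : ℝ => C * |s - t| ^ β :=
    continuous_const.mul ((by fun_prop : Continuous fun s : ℝ => |s - t|).rpow_const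
      fun _ => Or.inr hβ.le)
  simpa [hβ.ne'] using (this.tendsto t).mono_left nhdsWithin_le_nhds

lemma HolderOn.apply {d : ℕ} {β C a b : ℝ} {x : ℝ → E d} (h : HolderOn β C a b x) (j : Fin d) :
    HolderOn β C a b (fun t => x t j) := fun s hs t ht =>
  (PiLp.norm_apply_le (x s - x t) j).trans (h s hs t ht)

end Holder

/-! ### Increments of the vector field -/

lemma convex_cylinder {m : ℕ} (d : ℕ) (T : ℝ) {U : Set (E m)} (hU : Convex ℝ U) (M : ℝ) :
    Convex ℝ (cylinder d T U M) := by
  refine (convex_Icc 0 T).prod (hU.prod fun v hv w hw r s hr hs hrs j => ?_)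
  calc |(r • v + s • w) j| = |r * v j + s * w j| := by simp
    _ ≤ r * |v j| + s * |w j| := by
        refine (abs_add_le _ _).trans ?_
        rw [abs_mul, abs_mul, abs_of_nonneg hr, abs_of_nonneg hs]
    _ ≤ r * M + s * M := by
        have := hv j; have := hw j; gcongr
    _ = M := by rw [← add_mul, hrs, one_mul]

lemma cylinder_subset {m : ℕ} (d : ℕ) (T : ℝ) (U : Set (E m)) (M : ℝ) :
    cylinder d T U M ⊆ Icc (0 : ℝ) T ×ˢ univ :=
  prod_mono le_rfl (subset_univ _)

/-- The mixed second difference of a function with Hölder continuous derivative: the mean value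
inequality along the segments from `p'` to `p` and from `q'` to `q`. -/
lemma IsC1Holder.abs_sub_sub_sub_le {m d : ℕ} {T θ M : ℝ} {U : Set (E m)} {K : ℝ≥0}
    {f : ℝ × E m × E d → ℝ} (hf : IsC1Holder T θ U M K f) (hU : Convex ℝ U) (hθ : 0 ≤ θ)
    {p p' q q' : ℝ × E m × E d} (hp : p ∈ cylinder d T U M) (hp' : p' ∈ cylinder d T U M)
    (hq : q ∈ cylinder d T U M) (hq' : q' ∈ cylinder d T U M) {R : ℝ}
    (hR : ‖p - q‖ ≤ R) (hR' : ‖p' - q'‖ ≤ R) :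
    |(f p - f p') - (f q - f q')| ≤
      K * ‖(p - p') - (q - q')‖ + K * R ^ θ * ‖q - q'‖ := by
  set D : Set (ℝ × E m × E d) := Icc (0 : ℝ) T ×ˢ univ with hD
  have hseg : ∀ {u v : ℝ × E m × E d}, u ∈ cylinder d T U M → v ∈ cylinder d T U M →
      ∀ r ∈ Icc (0 : ℝ) 1, v + r • (u - v) ∈ cylinder d T U M := fun hu hv r hr =>
    (convex_cylinder d T hU M).add_smul_sub_mem hv hu hr
  have hder : ∀ {u v : ℝ × E m × E d}, u ∈ cylinder d T U M → v ∈ cylinder d T U M →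
      ∀ r ∈ Icc (0 : ℝ) 1, HasDerivWithinAt (fun r : ℝ => f (v + r • (u - v)))
        (fderivWithin ℝ f D (v + r • (u - v)) (u - v)) (Icc 0 1) r := by
    intro u v hu hv r hr
    have h1 : HasFDerivWithinAt f (fderivWithin ℝ f D (v + r • (u - v))) D (v + r • (u - v)) :=
      (hf.contDiffOn.differentiableOn one_ne_zero _
        (cylinder_subset d T U M (hseg hu hv r hr))).hasFDerivWithinAt
    have h2 : HasDerivWithinAt (fun r : ℝ => v + r • (u - v)) (u - v) (Icc 0 1) r := by
      simpa using (((hasDerivAt_id r).smul_const (u - v)).const_add v).hasDerivWithinAt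
    exact h1.comp_hasDerivWithinAt r h2 fun r hr => cylinder_subset d T U M (hseg hu hv r hr)
  have h := norm_image_sub_le_of_norm_deriv_le_segment_01'
    (f := fun r : ℝ => f (p' + r • (p - p')) - f (q' + r • (q - q')))
    (C := K * ‖(p - p') - (q - q')‖ + K * R ^ θ * ‖q - q'‖)
    (fun r hr => (hder hp hp' r hr).sub (hder hq hq' r hr)) ?_
  · simp only [one_smul, zero_smul, add_zero, add_sub_cancel, Real.norm_eq_abs] at h
    rwa [show f p - f q - (f p' - f q') = (f p - f p') - (f q - f q') by ring] at h
  intro r hr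
  have hr' : r ∈ Icc (0 : ℝ) 1 := ⟨hr.1, hr.2.le⟩
  have hP := hseg hp hp' r hr'
  have hQ := hseg hq hq' r hr'
  set P := p' + r • (p - p') with hPdef
  set Q := q' + r • (q - q') with hQdef
  have hPQ : ‖P - Q‖ ≤ R := by
    have e : P - Q = (1 - r) • (p' - q') + r • (p - q) := by
      rw [hPdef, hQdef]; module
    rw [e]
    calc ‖(1 - r) • (p' - q') + r • (p - q)‖ ≤ (1 - r) * ‖p' - q'‖ + r * ‖p - q‖ := by
          refine (norm_add_le _ _).trans_eq ?_
          rw [norm_smul, norm_smul, Real.norm_of_nonneg hr.1,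
            Real.norm_of_nonneg (sub_nonneg.2 hr'.2)]
      _ ≤ (1 - r) * R + r * R := by
          have := sub_nonneg.2 hr'.2; have := hr'.1; gcongr
      _ = R := by ring
  have e : fderivWithin ℝ f D P (p - p') - fderivWithin ℝ f D Q (q - q') =
      fderivWithin ℝ f D P ((p - p') - (q - q'))
        + (fderivWithin ℝ f D P - fderivWithin ℝ f D Q) (q - q') := by
    simp only [map_sub, sub_apply]; ring
  rw [e]
  refine (norm_add_le _ _).trans (add_le_add ?_ ?_)
  · exact ((fderivWithin ℝ f D P).le_opNorm _).trans
      (mul_le_mul_of_nonneg_right (hf.deriv_le P hP) (norm_nonneg _))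
  · refine ((fderivWithin ℝ f D P - fderivWithin ℝ f D Q).le_opNorm _).trans
      (mul_le_mul_of_nonneg_right ((hf.deriv_holder P hP Q hQ).trans ?_) (norm_nonneg _))
    gcongr

lemma IsC1Holder.abs_sub_le {m d : ℕ} {T θ M : ℝ} {U : Set (E m)} {K : ℝ≥0}
    {f : ℝ × E m × E d → ℝ} (hf : IsC1Holder T θ U M K f) (hU : Convex ℝ U) (hθ : 0 ≤ θ)
    {p q : ℝ × E m × E d} (hp : p ∈ cylinder d T U M) (hq : q ∈ cylinder d T U M) :
    |f p - f q| ≤ K * ‖p - q‖ := by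
  simpa using hf.abs_sub_sub_sub_le hU hθ hp hq hq hq le_rfl (by simp)

/-- The point `x` with its `j`-th coordinate replaced by `ξ`. -/
def replaceCoord {d : ℕ} (x : E d) (j : Fin d) (ξ : ℝ) : E d :=
  WithLp.toLp 2 (Function.update x.ofLp j ξ)

lemma replaceCoord_sub {d : ℕ} (x x' : E d) (j : Fin d) (ξ ξ' : ℝ) :
    replaceCoord x j ξ - replaceCoord x' j ξ' = replaceCoord (x - x') j (ξ - ξ') := by
  ext k
  rcases eq_or_ne k j with rfl | h
  · simp [replaceCoord]
  · simp [replaceCoord, h]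

lemma norm_replaceCoord_zero_le {d : ℕ} (x : E d) (j : Fin d) : ‖replaceCoord x j 0‖ ≤ ‖x‖ := by
  rw [EuclideanSpace.norm_eq, EuclideanSpace.norm_eq]
  refine Real.sqrt_le_sqrt (Finset.sum_le_sum fun k _ => ?_)
  rcases eq_or_ne k j with rfl | h
  · have h0 : ‖(replaceCoord x k 0) k‖ = 0 := by simp [replaceCoord]
    rw [h0, zero_pow two_ne_zero]; positivity
  · simp [replaceCoord, h]

lemma norm_replaceCoord_zero {d : ℕ} (j : Fin d) (ξ : ℝ) : ‖replaceCoord (0 : E d) j ξ‖ = |ξ| := by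
  have : replaceCoord (0 : E d) j ξ = EuclideanSpace.single j ξ := by
    ext k
    rcases eq_or_ne k j with rfl | h
    · simp [replaceCoord]
    · simp [replaceCoord, h]
  rw [this]; simp

/-- The data of one of the two equations: the field, the driving path and a path `y` with values
in `U`, with their quantitative bounds. -/
structure IsInput {m d : ℕ} (T α θ : ℝ) (U : Set (E m)) (M : ℝ) (K : ℝ≥0) (F : Field m d)
    (x : ℝ → E d) (y : ℝ → E m) : Prop where
  field : ∀ i j, IsC1Holder T θ U M K (fun p => F p.1 p.2.1 p.2.2 i j)
  bound : ∀ t ∈ Icc (0 : ℝ) T, ∀ j, |x t j| ≤ M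
  holder : HolderOn α K 0 T x
  mem : ∀ t ∈ Icc (0 : ℝ) T, y t ∈ U

section Slice

variable {m d : ℕ} {T α θ M : ℝ} {U : Set (E m)} {K : ℝ≥0} {F F' : Field m d}
  {x x' : ℝ → E d} {y y' : ℝ → E m}

lemma mem_cylinder (hb : ∀ t ∈ Icc (0 : ℝ) T, ∀ j, |x t j| ≤ M)
    (hm : ∀ t ∈ Icc (0 : ℝ) T, y t ∈ U) {t ξ : ℝ} (ht : t ∈ Icc (0 : ℝ) T) (hξ : |ξ| ≤ M)
    (j : Fin d) : (t, y t, replaceCoord (x t) j ξ) ∈ cylinder d T U M := by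
  refine ⟨ht, hm t ht, fun k => ?_⟩
  rcases eq_or_ne k j with rfl | h
  · simpa [replaceCoord] using hξ
  · simpa [replaceCoord, h] using hb t ht k

lemma IsInput.mem_cylinder (h : IsInput T α θ U M K F x y) {t ξ : ℝ} (ht : t ∈ Icc (0 : ℝ) T)
    (hξ : |ξ| ≤ M) (j : Fin d) : (t, y t, replaceCoord (x t) j ξ) ∈ cylinder d T U M :=
  IrregularPath.mem_cylinder h.bound h.mem ht hξ j

lemma IsInput.continuous_slice (h : IsInput T α θ U M K F x y) (i : Fin m) (j : Fin d) {t : ℝ}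
    (ht : t ∈ Icc (0 : ℝ) T) : Continuous (slice F y x i j t) := by
  have h1 : Continuous fun ξ : ℝ => ((t, y t, replaceCoord (x t) j ξ) : ℝ × E m × E d) := by
    unfold replaceCoord
    fun_prop
  exact (h.field i j).contDiffOn.continuousOn.comp_continuous h1 fun ξ => ⟨ht, mem_univ _⟩

lemma IsInput.abs_slice_le (h : IsInput T α θ U M K F x y) (i : Fin m) (j : Fin d) {t ξ : ℝ}
    (ht : t ∈ Icc (0 : ℝ) T) (hξ : |ξ| ≤ M) : |slice F y x i j t ξ| ≤ K :=
  (h.field i j).norm_le _ (h.mem_cylinder ht hξ j)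

lemma norm_point_sub_le {s t r Y X ξ : ℝ} (j : Fin d) (hr0 : 0 ≤ r) (hY0 : 0 ≤ Y)
    (hX0 : 0 ≤ X) (hr : |s - t| ≤ r)
    (hy : ‖y s - y t‖ ≤ Y * r) (hx : ‖x s - x t‖ ≤ X * r) :
    ‖(s, y s, replaceCoord (x s) j ξ) - (t, y t, replaceCoord (x t) j ξ)‖ ≤ (1 + Y + X) * r := by
  have h1 : 0 ≤ Y * r := by positivity
  have h2 : 0 ≤ X * r := by positivity
  rw [Prod.mk_sub_mk, Prod.mk_sub_mk, replaceCoord_sub, sub_self, Prod.norm_mk, Prod.norm_mk]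
  refine max_le ?_ (max_le ?_ ((norm_replaceCoord_zero_le _ _).trans ?_))
  · rw [Real.norm_eq_abs]; linarith
  · linarith
  · linarith

lemma IsInput.abs_slice_sub_le (h : IsInput T α θ U M K F x y) (hU : Convex ℝ U) (hθ : 0 ≤ θ)
    (i : Fin m) (j : Fin d) {s t r Y X ξ : ℝ} (hs : s ∈ Icc (0 : ℝ) T) (ht : t ∈ Icc (0 : ℝ) T)
    (hξ : |ξ| ≤ M) (hr0 : 0 ≤ r) (hY0 : 0 ≤ Y) (hX0 : 0 ≤ X) (hr : |s - t| ≤ r)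
    (hy : ‖y s - y t‖ ≤ Y * r) (hx : ‖x s - x t‖ ≤ X * r) :
    |slice F y x i j s ξ - slice F y x i j t ξ| ≤ K * (1 + Y + X) * r := by
  refine ((h.field i j).abs_sub_le hU hθ (h.mem_cylinder hs hξ j)
    (h.mem_cylinder ht hξ j)).trans ?_
  rw [mul_assoc]
  gcongr
  exact norm_point_sub_le j hr0 hY0 hX0 hr hy hx

lemma point_sub_space (t : ℝ) (u : E m) (v : E d) (j : Fin d) (ξ η : ℝ) :
    ((t, u, replaceCoord v j ξ) - (t, u, replaceCoord v j η) : ℝ × E m × E d) =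
      (0, 0, replaceCoord 0 j (ξ - η)) := by
  rw [Prod.mk_sub_mk, Prod.mk_sub_mk, replaceCoord_sub, sub_self, sub_self, sub_self]

lemma norm_point_sub_space (t : ℝ) (u : E m) (v : E d) (j : Fin d) (ξ η : ℝ) :
    ‖((t, u, replaceCoord v j ξ) - (t, u, replaceCoord v j η) : ℝ × E m × E d)‖ = |ξ - η| := by
  rw [point_sub_space, Prod.norm_mk, Prod.norm_mk, norm_replaceCoord_zero]
  simp

lemma IsInput.abs_slice_sub_space_le (h : IsInput T α θ U M K F x y) (hU : Convex ℝ U)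
    (hθ : 0 ≤ θ) (i : Fin m) (j : Fin d) {t ξ η : ℝ} (ht : t ∈ Icc (0 : ℝ) T)
    (hξ : |ξ| ≤ M) (hη : |η| ≤ M) :
    |slice F y x i j t ξ - slice F y x i j t η| ≤ K * |ξ - η| := by
  refine ((h.field i j).abs_sub_le hU hθ (h.mem_cylinder ht hξ j)
    (h.mem_cylinder ht hη j)).trans_eq ?_
  rw [norm_point_sub_space]

lemma IsInput.abs_slice_mixed_le (h : IsInput T α θ U M K F x y) (hU : Convex ℝ U) (hθ : 0 ≤ θ)
    (i : Fin m) (j : Fin d) {s t r Y X ξ η : ℝ} (hs : s ∈ Icc (0 : ℝ) T)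
    (ht : t ∈ Icc (0 : ℝ) T) (hξ : |ξ| ≤ M) (hη : |η| ≤ M) (hr0 : 0 ≤ r) (hY0 : 0 ≤ Y)
    (hX0 : 0 ≤ X) (hr : |s - t| ≤ r) (hy : ‖y s - y t‖ ≤ Y * r) (hx : ‖x s - x t‖ ≤ X * r) :
    |(slice F y x i j s ξ - slice F y x i j t ξ) - (slice F y x i j s η - slice F y x i j t η)| ≤
      K * ((1 + Y + X) * r) ^ θ * |ξ - η| := by
  have := (h.field i j).abs_sub_sub_sub_le hU hθ (h.mem_cylinder hs hξ j)
    (h.mem_cylinder hs hη j) (h.mem_cylinder ht hξ j) (h.mem_cylinder ht hη j)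
    (norm_point_sub_le j hr0 hY0 hX0 hr hy hx) (norm_point_sub_le j hr0 hY0 hX0 hr hy hx)
  rw [norm_point_sub_space, point_sub_space, point_sub_space, sub_self, norm_zero, mul_zero,
    zero_add] at this
  rw [show ∀ u v w z : ℝ, (u - v) - (w - z) = (u - w) - (v - z) by intros; ring]
  exact this

lemma norm_point_sub_state_le (t : ℝ) (u u' : E m) (v v' : E d) (j : Fin d) (ξ : ℝ) :
    ‖((t, u, replaceCoord v j ξ) - (t, u', replaceCoord v' j ξ) : ℝ × E m × E d)‖ ≤
      ‖u - u'‖ + ‖v - v'‖ := by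
  have := norm_nonneg (u - u')
  have := norm_nonneg (v - v')
  rw [Prod.mk_sub_mk, Prod.mk_sub_mk, replaceCoord_sub, sub_self, sub_self, Prod.norm_mk,
    Prod.norm_mk, norm_zero]
  refine max_le (by linarith) (max_le (by linarith) ((norm_replaceCoord_zero_le _ _).trans ?_))
  linarith

/-- Replacing `(y, x)` by `(y', x')` in the field: only the states differ, so that the size of the
change is controlled by `y - y'` and `x - x'`. -/
lemma IsInput.abs_slice_sub_slice_le (h : IsInput T α θ U M K F x y)
    (hb : ∀ t ∈ Icc (0 : ℝ) T, ∀ j, |x' t j| ≤ M) (hm : ∀ t ∈ Icc (0 : ℝ) T, y' t ∈ U)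
    (hU : Convex ℝ U) (hθ : 0 ≤ θ) (i : Fin m) (j : Fin d) {t ξ : ℝ} (ht : t ∈ Icc (0 : ℝ) T)
    (hξ : |ξ| ≤ M) :
    |slice F y x i j t ξ - slice F y' x' i j t ξ| ≤ K * (‖y t - y' t‖ + ‖x t - x' t‖) := by
  refine ((h.field i j).abs_sub_le hU hθ (h.mem_cylinder ht hξ j)
    (IrregularPath.mem_cylinder hb hm ht hξ j)).trans ?_
  gcongr
  exact norm_point_sub_state_le _ _ _ _ _ _ _

/-- The increment in time of the change in `IsInput.abs_slice_sub_slice_le`. -/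
lemma IsInput.abs_slice_sub_slice_sub_le (h : IsInput T α θ U M K F x y)
    (hb : ∀ t ∈ Icc (0 : ℝ) T, ∀ j, |x' t j| ≤ M) (hm : ∀ t ∈ Icc (0 : ℝ) T, y' t ∈ U)
    (hU : Convex ℝ U) (hθ : 0 ≤ θ) (i : Fin m) (j : Fin d) {s t r Y X ξ : ℝ}
    (hs : s ∈ Icc (0 : ℝ) T) (ht : t ∈ Icc (0 : ℝ) T)
    (hξ : |ξ| ≤ M) (hr0 : 0 ≤ r) (hY0 : 0 ≤ Y) (hX0 : 0 ≤ X) (hr : |s - t| ≤ r)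
    (hy : ‖y s - y t‖ ≤ Y * r) (hx : ‖x s - x t‖ ≤ X * r)
    (hy' : ‖y' s - y' t‖ ≤ Y * r) (hx' : ‖x' s - x' t‖ ≤ X * r) :
    |(slice F y x i j s ξ - slice F y' x' i j s ξ)
        - (slice F y x i j t ξ - slice F y' x' i j t ξ)| ≤
      K * (‖(y s - y' s) - (y t - y' t)‖ + ‖(x s - x' s) - (x t - x' t)‖)
        + K * ((1 + Y + X) * r) ^ θ * (‖y t - y' t‖ + ‖x t - x' t‖) := by
  refine ((h.field i j).abs_sub_sub_sub_le hU hθ (h.mem_cylinder hs hξ j)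
    (IrregularPath.mem_cylinder hb hm hs hξ j) (h.mem_cylinder ht hξ j)
    (IrregularPath.mem_cylinder hb hm ht hξ j)
    (norm_point_sub_le j hr0 hY0 hX0 hr hy hx)
    (norm_point_sub_le j hr0 hY0 hX0 hr hy' hx')).trans ?_
  gcongr
  · have h1 := norm_nonneg ((y s - y' s) - (y t - y' t))
    have h2 := norm_nonneg ((x s - x' s) - (x t - x' t))
    rw [Prod.mk_sub_mk, Prod.mk_sub_mk, Prod.mk_sub_mk, Prod.mk_sub_mk, Prod.mk_sub_mk,
      Prod.mk_sub_mk, replaceCoord_sub, replaceCoord_sub, replaceCoord_sub, sub_self, sub_self,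
      sub_self, sub_self, Prod.norm_mk, Prod.norm_mk, norm_zero]
    refine max_le (by linarith) (max_le (by linarith) ((norm_replaceCoord_zero_le _ _).trans ?_))
    linarith
  · exact norm_point_sub_state_le _ _ _ _ _ _ _

lemma slice_sub_field (i : Fin m) (j : Fin d) (t ξ : ℝ) :
    slice (F - F') y x i j t ξ = slice F y x i j t ξ - slice F' y x i j t ξ := rfl

/-- The increment of a solution over `[a, b]` is the sum of the integrals over `[a, b]`. -/
lemma IsSolution.exists_integral_eq {β : ℝ} {y₀ : E m} (hsol : IsSolution β T x F y₀ y)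
    (h : IsInput T α θ U M K F x y) (hα : 0 < α) (hα1 : α ≤ 1) (hT1 : T ≤ 1) {a b : ℝ}
    (ha : 0 ≤ a) (hab : a ≤ b) (hb : b ≤ T) :
    ∃ I : Fin m → Fin d → ℝ,
      (∀ i j, HasPathIntegral (slice F y x i j) (fun s => x s j) a b (I i j)) ∧
      ∀ i, y b i - y a i = ∑ j, I i j := by
  obtain ⟨I, hI, hyI⟩ := hsol.integral_eq a ⟨ha, hab.trans hb⟩
  obtain ⟨J, hJ, hyJ⟩ := hsol.integral_eq b ⟨ha.trans hab, hb⟩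
  refine ⟨fun i j => J i j - I i j, fun i j => ?_, fun i => ?_⟩
  swap
  · rw [hyI, hyJ, Finset.sum_sub_distrib]; ring
  have hb0 := ha.trans hab
  have hsub : Icc 0 b ⊆ Icc 0 T := Icc_subset_Icc le_rfl hb
  have hhol : HolderOn α K 0 b (fun s => x s j) := (h.holder.mono le_rfl hb).apply j
  have hcont := hhol.continuousOn hα
  have htend : Tendsto (fun k : ℕ => (K : ℝ) * (2 * K * ((1 / 2 : ℝ) ^ k) ^ α)) atTop (𝓝 0) := by
    have h1 : Tendsto (fun k : ℕ => ((1 / 2 : ℝ) ^ k) ^ α) atTop (𝓝 (0 ^ α)) :=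
      ((tendsto_pow_atTop_nhds_zero_of_lt_one (by norm_num) (by norm_num)).rpow_const
        (Or.inr hα.le))
    rw [Real.zero_rpow hα.ne'] at h1
    simpa using (h1.const_mul (2 * K : ℝ)).const_mul (K : ℝ)
  refine HasPathIntegral.sub_left ha hab (hb.trans hT1) htend (fun k => by positivity)
    (fun k n hn => ?_) (hI i j) (hJ i j)
  have h0 : firstCell 0 k ≤ n := by simp [firstCell]
  have habs : ∀ n', n' + 1 ≤ endCell b k → |avg (fun s => x s j) k n'| ≤ M := by
    intro n' hn'
    obtain ⟨c, hc, e⟩ := avg_mem_image hcont hb0 (by simp [firstCell] : firstCell 0 k ≤ n') hn'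
    rw [← e]; exact h.bound c (hsub hc) j
  have ht : dyadic k (n + 1) ∈ Icc 0 T :=
    hsub (cell_subset hb0 h0 (by omega) (right_mem_Icc.2 (dyadic_lt_succ _ _).le))
  have h1 := intervalIntegral.norm_integral_le_of_norm_le_const
    (a := avg (fun s => x s j) k n) (b := avg (fun s => x s j) k (n + 1))
    (f := slice F y x i j (dyadic k (n + 1))) (C := K) fun ξ hξ => by
      refine h.abs_slice_le i j ht (abs_le.2 ?_)
      have := abs_le.1 (habs n (by omega))
      have := abs_le.1 (habs (n + 1) (by omega))
      have hξ' := uIoc_subset_uIcc hξ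
      rw [mem_uIcc] at hξ'
      constructor <;> rcases hξ' with h | h <;> linarith [h.1, h.2]
  refine h1.trans (mul_le_mul_of_nonneg_left ?_ K.coe_nonneg)
  exact abs_avg_succ_sub_le hcont hb0 K.coe_nonneg hα.le hα1 hhol h0 hn

end Slice

/-! ### From the seminorms to pointwise bounds and back -/

section Seminorm

variable {V : Type*} [NormedAddCommGroup V]

lemma holderWith_domRestrict_iff {β T : ℝ} (hβ : 0 ≤ β) {f : ℝ → V} {C : ℝ≥0} :
    HolderWith C β.toNNReal ((Icc (0 : ℝ) T).domRestrict f) ↔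
      ∀ s ∈ Icc (0 : ℝ) T, ∀ t ∈ Icc (0 : ℝ) T, ‖f s - f t‖ ≤ C * |s - t| ^ β := by
  have key : ∀ s t : ℝ, edist (f s) (f t) ≤ C * edist s t ^ ((β.toNNReal : ℝ≥0) : ℝ) ↔
      ‖f s - f t‖ ≤ C * |s - t| ^ β := by
    intro s t
    rw [Real.coe_toNNReal _ hβ, edist_dist, edist_dist, Real.dist_eq, dist_eq_norm,
      ENNReal.ofReal_rpow_of_nonneg (abs_nonneg _) hβ, ← ENNReal.ofReal_coe_nnreal,
      ← ENNReal.ofReal_mul C.coe_nonneg, ENNReal.ofReal_le_ofReal_iff (by positivity)]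
  exact ⟨fun h s hs t ht => (key s t).1 (h ⟨s, hs⟩ ⟨t, ht⟩),
    fun h s t => (key s t).2 (h s s.2 t t.2)⟩

lemma norm_sub_le_of_holderSeminorm_le {β T : ℝ} (hβ : 0 ≤ β) {f : ℝ → V} {C : ℝ≥0}
    (h : holderSeminorm β T f ≤ C) :
    ∀ s ∈ Icc (0 : ℝ) T, ∀ t ∈ Icc (0 : ℝ) T, ‖f s - f t‖ ≤ C * |s - t| ^ β := by
  have hm : MemHolder β.toNNReal ((Icc (0 : ℝ) T).domRestrict f) :=
    eHolderNorm_lt_top.1 (h.trans_lt ENNReal.coe_lt_top)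
  have hC : nnHolderNorm β.toNNReal ((Icc (0 : ℝ) T).domRestrict f) ≤ C := by
    rw [← ENNReal.coe_le_coe, hm.coe_nnHolderNorm_eq_eHolderNorm]; exact h
  exact (holderWith_domRestrict_iff hβ).1 (hm.holderWith.mono hC)

lemma holderSeminorm_le {β T : ℝ} (hβ : 0 ≤ β) {f : ℝ → V} {C : ℝ≥0}
    (h : ∀ s ∈ Icc (0 : ℝ) T, ∀ t ∈ Icc (0 : ℝ) T, ‖f s - f t‖ ≤ C * |s - t| ^ β) :
    holderSeminorm β T f ≤ C :=
  ((holderWith_domRestrict_iff hβ).2 h).eHolderNorm_le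

lemma norm_le_of_supNorm_le {T : ℝ} {f : ℝ → V} {C : ℝ≥0} (h : supNorm T f ≤ C) :
    ∀ t ∈ Icc (0 : ℝ) T, ‖f t‖ ≤ C := by
  intro t ht
  have : ‖f t‖ₑ ≤ C := (le_iSup₂ (f := fun t (_ : t ∈ Icc (0 : ℝ) T) => ‖f t‖ₑ) t ht).trans h
  exact_mod_cast this

end Seminorm

lemma levyMu_le_of_gSeminorm_le {d : ℕ} {β γ T : ℝ} {x : ℝ → E d} {C : ℝ≥0}
    (h : gSeminorm β γ T x ≤ C) (j : Fin d) {a b : ℝ} (ha : 0 ≤ a) (hab : a < b) (hb : b ≤ T)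
    {k₀ : ℕ} (hk : (1 / 2 : ℝ) ^ (k₀ + 1) ≤ b - a ∧ b - a ≤ 2 * (1 / 2 : ℝ) ^ k₀) :
    levyMu (fun t => x t j) a b β k₀ ≤ ENNReal.ofReal (C * (b - a) ^ (β + γ)) := by
  have hpos : 0 < (b - a) ^ (β + γ) := Real.rpow_pos_of_pos (sub_pos.2 hab) _
  have h1 : levyMu (fun t => x t j) a b β k₀ / ENNReal.ofReal ((b - a) ^ (β + γ)) ≤ C := by
    refine le_trans ?_ h
    unfold gSeminorm
    refine le_iSup_of_le j (le_iSup_of_le a (le_iSup_of_le b (le_iSup_of_le ⟨ha, hab, hb⟩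
      (le_iSup_of_le k₀ (le_iSup_of_le hk le_rfl)))))
  rw [ENNReal.div_le_iff (by simpa using hpos) ENNReal.ofReal_ne_top] at h1
  rwa [ENNReal.ofReal_mul C.coe_nonneg, ENNReal.ofReal_coe_nnreal]

lemma abs_slice_le_of_fieldSup_le {m d : ℕ} {T : ℝ} {y : ℝ → E m} {x : ℝ → E d} {F : Field m d}
    {C : ℝ≥0} (h : fieldSup T y x F ≤ C) (i : Fin m) (j : Fin d) :
    ∀ t ∈ Icc (0 : ℝ) T, ∀ ξ ∈ (fun s => x s j) '' Icc (0 : ℝ) T, |slice F y x i j t ξ| ≤ C := by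
  intro t ht ξ hξ
  refine norm_le_of_supNorm_le (f := fun t => slice F y x i j t ξ) (le_trans ?_ h) t ht
  unfold fieldSup
  exact le_iSup_of_le i (le_iSup_of_le j (le_iSup₂_of_le ξ hξ le_rfl))

lemma abs_slice_sub_le_of_fieldHolder_le {m d : ℕ} {β T : ℝ} (hβ : 0 ≤ β) {y : ℝ → E m}
    {x : ℝ → E d} {F : Field m d} {C : ℝ≥0} (h : fieldHolder β T y x F ≤ C) (i : Fin m)
    (j : Fin d) :
    ∀ s ∈ Icc (0 : ℝ) T, ∀ t ∈ Icc (0 : ℝ) T, ∀ ξ ∈ (fun s => x s j) '' Icc (0 : ℝ) T,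
      |slice F y x i j s ξ - slice F y x i j t ξ| ≤ C * |s - t| ^ β := by
  intro s hs t ht ξ hξ
  refine norm_sub_le_of_holderSeminorm_le hβ (f := fun t => slice F y x i j t ξ) (le_trans ?_ h)
    s hs t ht
  unfold fieldHolder
  exact le_iSup_of_le i (le_iSup_of_le j (le_iSup₂_of_le ξ hξ le_rfl))

lemma exists_dyadic_scale {r : ℝ} (h0 : 0 < r) (h1 : r ≤ 1) :
    ∃ k₀ : ℕ, (1 / 2 : ℝ) ^ (k₀ + 1) ≤ r ∧ r ≤ 2 * (1 / 2 : ℝ) ^ k₀ := by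
  obtain ⟨n, hn, hn'⟩ := exists_nat_pow_near_of_lt_one h0 h1 (by norm_num : (0 : ℝ) < 1 / 2)
    (by norm_num)
  have : (0 : ℝ) < (1 / 2) ^ n := by positivity
  exact ⟨n, hn.le, by linarith⟩

/-! ### Absorption and continuation -/

section Absorption

variable {V : Type*} [NormedAddCommGroup V]

/-- If every Hölder constant `H` can be improved to `Q + H / 2`, then `2 Q` is a Hölder
constant. -/
lemma HolderOn.of_improvement {β a b Q H₀ : ℝ} {f : ℝ → V} (hQ : 0 ≤ Q) (hH₀ : 0 ≤ H₀)
    (h₀ : HolderOn β H₀ a b f)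
    (step : ∀ H, 0 ≤ H → HolderOn β H a b f → ∀ s ∈ Icc a b, ∀ t ∈ Icc a b, s < t →
      ‖f t - f s‖ ≤ (Q + H / 2) * (t - s) ^ β) :
    HolderOn β (2 * Q) a b f := by
  have step' : ∀ H, 0 ≤ H → HolderOn β H a b f → HolderOn β (Q + H / 2) a b f := by
    intro H hH hf s hs t ht
    rcases lt_trichotomy s t with h | rfl | h
    · rw [norm_sub_rev, abs_sub_comm, abs_of_pos (sub_pos.2 h)]
      exact step H hH hf s hs t ht h
    · rw [sub_self, norm_zero]; positivity
    · rw [abs_of_pos (sub_pos.2 h)]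
      exact step H hH hf t ht s hs h
  have hn : ∀ n : ℕ, HolderOn β (2 * Q + H₀ * (1 / 2) ^ n) a b f := by
    intro n
    induction n with
    | zero =>
      intro s hs t ht
      refine (h₀ s hs t ht).trans (mul_le_mul_of_nonneg_right (by simpa using hQ) ?_)
      positivity
    | succ n ih =>
      have h := step' _ (by positivity) ih
      rwa [show Q + (2 * Q + H₀ * (1 / 2) ^ n) / 2 = 2 * Q + H₀ * (1 / 2) ^ (n + 1) by
        rw [pow_succ]; ring] at h
  intro s hs t ht
  have hlim : Tendsto (fun n : ℕ => (2 * Q + H₀ * (1 / 2 : ℝ) ^ n) * |s - t| ^ β) atTop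
      (𝓝 ((2 * Q + H₀ * 0) * |s - t| ^ β)) :=
    (((tendsto_pow_atTop_nhds_zero_of_lt_one (by norm_num) (by norm_num)).const_mul H₀).const_add
      (2 * Q)).mul_const _
  rw [mul_zero, add_zero] at hlim
  exact ge_of_tendsto' hlim fun n => hn n s hs t ht

/-- A linear bound for the increments over intervals of length at most `δ` yields a bound for the
Hölder constant on `[0, T]`, by continuation over `1 / δ` intervals. -/
lemma HolderOn.of_local {β c δ D T : ℝ} {f : ℝ → V} (hβ : 0 ≤ β) (hc : 0 ≤ c) (hδ : 0 < δ)
    (hD : 0 ≤ D) (hT : T ≤ 1)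
    (h : ∀ a b, 0 ≤ a → a < b → b ≤ T → b - a ≤ δ →
      ‖f b - f a‖ ≤ c * (‖f a‖ + D) * (b - a) ^ β) :
    HolderOn β ((c + 2 / δ ^ β) * (1 + c) ^ ⌈1 / δ⌉₊ * (‖f 0‖ + D)) 0 T f := by
  have hstep : ∀ n : ℕ, ∀ t ∈ Icc (0 : ℝ) T, t ≤ n * δ →
      ‖f t‖ + D ≤ (1 + c) ^ n * (‖f 0‖ + D) := by
    intro n
    induction n with
    | zero =>
      intro t ht htn
      have : t = 0 := le_antisymm (by simpa using htn) ht.1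
      simp [this]
    | succ n ih =>
      intro t ht htn
      have hQ : 0 ≤ ‖f 0‖ + D := by positivity
      rcases le_or_gt t (n * δ) with h1 | h1
      · refine (ih t ht h1).trans (mul_le_mul_of_nonneg_right ?_ hQ)
        exact pow_le_pow_right₀ (by linarith) (Nat.le_succ n)
      · have hs : (n : ℝ) * δ ∈ Icc 0 T := ⟨by positivity, h1.le.trans ht.2⟩
        have h2 := h (n * δ) t hs.1 h1 ht.2 (by push_cast at htn; linarith)
        have h3 := ih _ hs le_rfl
        have h4 : (t - n * δ) ^ β ≤ 1 :=
          Real.rpow_le_one (sub_nonneg.2 h1.le) (by linarith [hs.1, ht.2]) hβ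
        have h5 : 0 ≤ c * (‖f (n * δ)‖ + D) := by positivity
        have h6 : ‖f t‖ ≤ ‖f t - f (n * δ)‖ + ‖f (n * δ)‖ := by
          simpa using norm_add_le (f t - f (n * δ)) (f (n * δ))
        calc ‖f t‖ + D ≤ (1 + c) * (‖f (n * δ)‖ + D) := by
              have := h2.trans (mul_le_of_le_one_right h5 h4)
              linarith
          _ ≤ (1 + c) * ((1 + c) ^ n * (‖f 0‖ + D)) := by gcongr
          _ = _ := by ring
  set N := ⌈1 / δ⌉₊ with hN
  have hsup : ∀ t ∈ Icc (0 : ℝ) T, ‖f t‖ + D ≤ (1 + c) ^ N * (‖f 0‖ + D) := by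
    intro t ht
    refine hstep N t ht ?_
    have := Nat.le_ceil (1 / δ)
    rw [div_le_iff₀ hδ] at this
    linarith [ht.2]
  set B := (1 + c) ^ N * (‖f 0‖ + D) with hB
  have hB0 : 0 ≤ B := by positivity
  have key : ∀ s ∈ Icc 0 T, ∀ t ∈ Icc 0 T, s < t →
      ‖f t - f s‖ ≤ (c + 2 / δ ^ β) * B * (t - s) ^ β := by
    intro s hs t ht hst
    have hts := sub_pos.2 hst
    have h2 : 0 ≤ (t - s) ^ β := by positivity
    rcases le_or_gt (t - s) δ with h1 | h1
    · refine (h s t hs.1 hst ht.2 h1).trans (mul_le_mul_of_nonneg_right ?_ h2)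
      refine (mul_le_mul_of_nonneg_left (hsup s hs) hc).trans ?_
      have : 0 ≤ 2 / δ ^ β := by positivity
      nlinarith
    · have h3 : 1 ≤ (t - s) ^ β / δ ^ β := by
        rw [one_le_div (by positivity)]
        gcongr
      have h4 : ‖f t - f s‖ ≤ 2 * B := by
        have := norm_sub_le (f t) (f s)
        have := hsup s hs
        have := hsup t ht
        linarith
      calc ‖f t - f s‖ ≤ 2 * B * 1 := by linarith
        _ ≤ 2 * B * ((t - s) ^ β / δ ^ β) := by gcongr
        _ = 2 / δ ^ β * B * (t - s) ^ β := by ring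
        _ ≤ (c + 2 / δ ^ β) * B * (t - s) ^ β := by gcongr; linarith
  intro s hs t ht
  rw [mul_assoc (c + 2 / δ ^ β)]
  rcases lt_trichotomy s t with h | rfl | h
  · rw [norm_sub_rev, abs_sub_comm, abs_of_pos (sub_pos.2 h)]
    exact key s hs t ht h
  · rw [sub_self, norm_zero]; positivity
  · rw [abs_of_pos (sub_pos.2 h)]
    exact key t ht s hs h

end Absorption

lemma exists_small_rpow {c ε : ℝ} (hc : 0 ≤ c) (hε : 0 < ε) :
    ∃ δ : ℝ, 0 < δ ∧ δ ≤ 1 ∧ c * δ ^ ε ≤ 1 / 2 := by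
  have h1 : (0 : ℝ) < 1 / (2 * c + 1) := by positivity
  refine ⟨(1 / (2 * c + 1)) ^ (1 / ε), by positivity, Real.rpow_le_one h1.le ?_ (by positivity), ?_⟩
  · rw [div_le_one (by positivity)]; linarith
  · rw [← Real.rpow_mul h1.le, one_div_mul_cancel hε.ne', Real.rpow_one, mul_one_div,
      div_le_iff₀ (by positivity)]
    linarith

lemma norm_le_card_mul {n : ℕ} {v : E n} {B : ℝ} (h : ∀ i, |v i| ≤ B) :
    ‖v‖ ≤ n * B := by
  have h1 : ‖v‖ ≤ ∑ i, |v i| := by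
    rw [EuclideanSpace.norm_eq]
    refine Real.sqrt_le_iff.2 ⟨Finset.sum_nonneg fun i _ => abs_nonneg _, ?_⟩
    exact Finset.sum_sq_le_sq_sum_of_nonneg fun i _ => abs_nonneg _
  refine h1.trans ((Finset.sum_le_card_nsmul _ _ B fun i _ => h i).trans_eq ?_)
  simp

/-! ### Increments of solutions over short intervals -/

lemma polygonIntegral_zero (g : ℝ → ℝ) (a b : ℝ) (k : ℕ) :
    polygonIntegral (fun _ _ => 0) g a b k = 0 := by
  simp [polygonIntegral]

lemma levyMu_sub_self (g : ℝ → ℝ) (a b β : ℝ) (k₀ : ℕ) :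
    levyMu (fun t => g t - g t) a b β k₀ = 0 := by
  simp [levyMu, avg]

lemma IsSolution.apply_zero {m d : ℕ} {β T : ℝ} (hT : 0 ≤ T) {x : ℝ → E d} {F : Field m d}
    {y₀ : E m} {y : ℝ → E m} (h : IsSolution β T x F y₀ y) : y 0 = y₀ := by
  obtain ⟨I, hI, hy⟩ := h.integral_eq 0 ⟨le_rfl, hT⟩
  ext i
  rw [hy i]
  have : ∀ j, I i j = 0 := fun j => by
    refine tendsto_nhds_unique ((tendsto_add_atTop_iff_nat 1).2 (hI i j)) ?_
    refine tendsto_const_nhds.congr fun k => ?_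
    simp [polygonIntegral, cells_succ le_rfl zero_le_one, endCell]
  simp [this]

section Increment

variable {m d : ℕ} {T α β β₀ γ θ M : ℝ} {U : Set (E m)} {K : ℝ≥0} {F F' : Field m d}
  {x x' : ℝ → E d} {y₀ y₀' : E m} {y y' : ℝ → E m} {a b H : ℝ}

/-- The increment of one solution: the stability estimate against the zero integrand. -/
lemma IsSolution.norm_sub_le (hsol : IsSolution β T x F y₀ y) (h : IsInput T α θ U M K F x y)
    (hU : Convex ℝ U) (hθ : 0 ≤ θ) (hT1 : T ≤ 1) (hβ₀ : 0 < β₀) (hβ₀β : β₀ ≤ β) (hβα : β ≤ α)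
    (hα1 : α ≤ 1) (hG : gSeminorm β₀ γ T x ≤ K) (ha : 0 ≤ a) (hab : a < b) (hb : b ≤ T)
    (hH : 0 ≤ H) (hy : HolderOn β H a b y) :
    ‖y b - y a‖ ≤ m * (d * (K * (1 + H + K) * (K * (b - a) ^ (β₀ + γ))
      + geomConst α * (2 * (K * K)) * (b - a) ^ α)) := by
  have hα : 0 < α := by linarith
  have hsub : Icc a b ⊆ Icc 0 T := Icc_subset_Icc ha hb
  obtain ⟨k₀, hk⟩ := exists_dyadic_scale (sub_pos.2 hab) (by linarith)
  obtain ⟨I, hI, hyI⟩ := hsol.exists_integral_eq h hα hα1 hT1 ha hab.le hb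
  have hxH : HolderOn α K a b x := h.holder.mono ha hb
  have hdist : ∀ s ∈ Icc a b, ∀ t ∈ Icc a b, |s - t| ≤ 1 := fun s hs t ht => by
    rw [abs_le]; constructor <;> linarith [hs.1, hs.2, ht.1, ht.2]
  have hpow : ∀ s ∈ Icc a b, ∀ t ∈ Icc a b, ∀ p q : ℝ, 0 ≤ q → q ≤ p →
      |s - t| ^ p ≤ |s - t| ^ q := fun s hs t ht p q hq hqp =>
    Real.rpow_le_rpow_of_exponent_ge' (abs_nonneg _) (hdist s hs t ht) hq hqp
  refine norm_le_card_mul fun i => ?_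
  rw [PiLp.sub_apply, hyI i]
  refine (Finset.abs_sum_le_sum_abs _ _).trans ((Finset.sum_le_card_nsmul _ _
    (K * (1 + H + K) * (K * (b - a) ^ (β₀ + γ)) + geomConst α * (2 * (K * K)) * (b - a) ^ α)
    fun j _ => ?_).trans_eq
    (by rw [Finset.card_univ, Fintype.card_fin, nsmul_eq_mul]))
  have hbound : ∀ t ∈ Icc a b, |x t j| ≤ M := fun t ht => h.bound t (hsub ht) j
  have himg : ∀ ξ ∈ (fun t => x t j) '' Icc a b, |ξ| ≤ M := by
    rintro _ ⟨t, ht, rfl⟩; exact hbound t ht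
  have hxj := hxH.apply j
  have hba : 0 ≤ (b - a) ^ (β₀ + γ) := by have := sub_pos.2 hab; positivity
  have key := abs_pathIntegral_sub_le (f := slice F y x i j) (f' := fun _ _ => 0)
    (g := fun t => x t j) (g' := fun t => x t j) (α := α) (β := β) (β₀ := β₀) (M := M)
    (A := K * (1 + H + K)) (B := K) (H := 0) (Hx := 0) (S := 0) (L := 0) (G := K) (G' := 0)
    (ω := 0) (m := K * (b - a) ^ (β₀ + γ)) (m' := 0) (I := I i j) (I' := 0)
    ha hab (hb.trans hT1) hα hα1 hk.1 hk.2 (by positivity) K.coe_nonneg le_rfl le_rfl le_rfl le_rfl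
    K.coe_nonneg le_rfl le_rfl (by positivity) le_rfl
    (fun t ht => h.continuous_slice i j (hsub ht)) (fun t _ => continuous_const)
    (hxj.continuousOn hα) (hxj.continuousOn hα) hbound hbound hxj (by simp) (by simp)
    (fun s hs t ht ξ hξ => by
      have hp := hpow s hs t ht
      refine le_trans ?_ (mul_le_mul_of_nonneg_left (hp β β₀ hβ₀.le hβ₀β)
        (by positivity : 0 ≤ (K : ℝ) * (1 + H + K)))
      simp only [sub_zero]
      refine h.abs_slice_sub_le hU hθ i j (hsub hs) (hsub ht) (himg ξ hξ) (by positivity) hH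
        K.coe_nonneg ?_ (hy s hs t ht) ((hxH s hs t ht).trans ?_)
      · simpa using hp 1 β (by linarith) (by linarith)
      · exact mul_le_mul_of_nonneg_left (hp α β (by linarith) hβα) K.coe_nonneg)
    (fun t ht ξ hξ => by simpa using h.abs_slice_le i j (hsub ht) (himg ξ hξ))
    (by simp) (by simp) (by simp) (by simp)
    (levyMu_le_of_gSeminorm_le hG j ha hab hb hk) (by rw [levyMu_sub_self]; simp) (hI i j)
    (tendsto_const_nhds.congr fun k => (polygonIntegral_zero _ _ _ _).symm)
  simpa using key

/-- The increment of the difference of two solutions. The integrand of the second equation is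
`f'`; the difference `f - f'` of the integrands is split into the change of the field, at the state
of the first solution, and the change of the state, in the second field. -/
lemma norm_solution_sub_sub_le (hsol : IsSolution β T x F y₀ y)
    (hsol' : IsSolution β T x' F' y₀' y') (h : IsInput T α θ U M K F x y)
    (h' : IsInput T α θ U M K F' x' y')
    (hU : Convex ℝ U) (hθ : 0 ≤ θ) (hθ1 : θ ≤ 1) (hT1 : T ≤ 1) (hβ₀ : 0 < β₀)
    (hβ₀β : β₀ ≤ θ * β) (hβα : β ≤ α) (hα1 : α ≤ 1)
    (hG : gSeminorm β₀ γ T x ≤ K) {D : ℝ≥0} (hDG : gSeminorm β γ T (x' - x) ≤ D)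
    (hDα : holderSeminorm α T (x - x') ≤ D) (hDC : supNorm T (x - x') ≤ D)
    (hDH : fieldHolder β T y x (F - F') ≤ D) (hDS : fieldSup T y x (F - F') ≤ D)
    (ha : 0 ≤ a) (hab : a < b) (hb : b ≤ T) {Y W : ℝ}
    (hY0 : 0 ≤ Y) (hY : HolderOn β Y a b y) (hY' : HolderOn β Y a b y')
    (hH : 0 ≤ H) (hΔ : HolderOn β H a b (y - y'))
    (hW : ∀ t ∈ Icc a b, ‖(y - y') t‖ + D ≤ W) :
    ‖(y - y') b - (y - y') a‖ ≤ m * (d * (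
      (D + K * (H + D) + K * (1 + Y + K) * W + K * (1 + Y + K) * D) * (K * (b - a) ^ (β₀ + γ))
      + K * (1 + Y + K) * (D * (b - a) ^ (β + γ))
      + geomConst α * (2 * ((D + K * W + K * D) * K + K * D)) * (b - a) ^ α)) := by
  have hβ : 0 < β := by
    rcases hθ.eq_or_lt with h0 | h0
    · rw [← h0] at hβ₀β; linarith
    · exact pos_of_mul_pos_right (hβ₀.trans_le hβ₀β) h0.le
  have hα : 0 < α := by linarith
  have hββ₀ : β₀ ≤ β := hβ₀β.trans (mul_le_of_le_one_left hβ.le hθ1)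
  have hsub : Icc a b ⊆ Icc 0 T := Icc_subset_Icc ha hb
  obtain ⟨k₀, hk⟩ := exists_dyadic_scale (sub_pos.2 hab) (by linarith)
  obtain ⟨I, hI, hyI⟩ := hsol.exists_integral_eq h hα hα1 hT1 ha hab.le hb
  obtain ⟨I', hI', hyI'⟩ := hsol'.exists_integral_eq h' hα hα1 hT1 ha hab.le hb
  have hxH : HolderOn α K a b x := h.holder.mono ha hb
  have hxH' : HolderOn α K a b x' := h'.holder.mono ha hb
  have hxD : HolderOn α D a b (x - x') :=
    HolderOn.mono (norm_sub_le_of_holderSeminorm_le hα.le hDα) ha hb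
  have hW0 : 0 ≤ W :=
    (add_nonneg (norm_nonneg _) D.coe_nonneg).trans (hW a (left_mem_Icc.2 hab.le))
  have hdist : ∀ s ∈ Icc a b, ∀ t ∈ Icc a b, |s - t| ≤ 1 := fun s hs t ht => by
    rw [abs_le]; constructor <;> linarith [hs.1, hs.2, ht.1, ht.2]
  have hpow : ∀ s ∈ Icc a b, ∀ t ∈ Icc a b, ∀ p q : ℝ, 0 ≤ q → q ≤ p →
      |s - t| ^ p ≤ |s - t| ^ q := fun s hs t ht p q hq hqp =>
    Real.rpow_le_rpow_of_exponent_ge' (abs_nonneg _) (hdist s hs t ht) hq hqp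
  have hpow1 : ∀ s ∈ Icc a b, ∀ t ∈ Icc a b, |s - t| ≤ |s - t| ^ β := fun s hs t ht => by
    simpa using hpow s hs t ht 1 β hβ.le (by linarith)
  have hKpow : ∀ {z : ℝ → E d}, HolderOn α K a b z → ∀ s ∈ Icc a b, ∀ t ∈ Icc a b,
      ‖z s - z t‖ ≤ K * |s - t| ^ β := fun hz s hs t ht =>
    (hz s hs t ht).trans (mul_le_mul_of_nonneg_left (hpow s hs t ht α β hβ.le hβα) K.coe_nonneg)
  -- `θ`-Hölder continuity of the derivative along the solutions, which are `β`-Hölder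
  have hθpow : ∀ s ∈ Icc a b, ∀ t ∈ Icc a b,
      ((1 + Y + K) * |s - t| ^ β) ^ θ ≤ (1 + Y + K) * |s - t| ^ β₀ := fun s hs t ht => by
    have hK := K.coe_nonneg
    rw [Real.mul_rpow (by positivity) (by positivity), ← Real.rpow_mul (abs_nonneg _), mul_comm β]
    have h1 : (1 + Y + K) ^ θ ≤ (1 + Y + K) ^ (1 : ℝ) :=
      Real.rpow_le_rpow_of_exponent_le (by linarith) hθ1
    rw [Real.rpow_one] at h1
    exact mul_le_mul h1 (hpow s hs t ht _ _ hβ₀.le hβ₀β) (by positivity) (by positivity)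
  have hstate : ∀ t ∈ Icc a b, ‖y t - y' t‖ + ‖x t - x' t‖ ≤ W := fun t ht =>
    (add_le_add le_rfl (norm_le_of_supNorm_le hDC t (hsub ht))).trans (hW t ht)
  have e : (y - y') b - (y - y') a = (y b - y a) - (y' b - y' a) := by
    simp only [Pi.sub_apply]; abel
  rw [e]
  refine norm_le_card_mul fun i => ?_
  rw [PiLp.sub_apply, PiLp.sub_apply, PiLp.sub_apply, hyI i, hyI' i, ← Finset.sum_sub_distrib]
  refine (Finset.abs_sum_le_sum_abs _ _).trans ((Finset.sum_le_card_nsmul _ _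
    ((D + K * (H + D) + K * (1 + Y + K) * W + K * (1 + Y + K) * D) * (K * (b - a) ^ (β₀ + γ))
      + K * (1 + Y + K) * (D * (b - a) ^ (β + γ))
      + geomConst α * (2 * ((D + K * W + K * D) * K + K * D)) * (b - a) ^ α)
    fun j _ => ?_).trans_eq
    (by rw [Finset.card_univ, Fintype.card_fin, nsmul_eq_mul]))
  have hbound : ∀ t ∈ Icc a b, |x t j| ≤ M := fun t ht => h.bound t (hsub ht) j
  have hbound' : ∀ t ∈ Icc a b, |x' t j| ≤ M := fun t ht => h'.bound t (hsub ht) j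
  have himg : ∀ ξ ∈ (fun t => x t j) '' Icc a b, |ξ| ≤ M := by
    rintro _ ⟨t, ht, rfl⟩; exact hbound t ht
  have himg' : (fun t => x t j) '' Icc a b ⊆ (fun t => x t j) '' Icc 0 T := image_mono hsub
  have hba : 0 ≤ (b - a) ^ (β₀ + γ) := by have := sub_pos.2 hab; positivity
  have hba' : 0 ≤ (b - a) ^ (β + γ) := by have := sub_pos.2 hab; positivity
  have hG' := levyMu_le_of_gSeminorm_le hDG j ha hab hb hk
  simp only [Pi.sub_apply, PiLp.sub_apply] at hG'
  exact abs_pathIntegral_sub_le (f := slice F y x i j) (f' := slice F' y' x' i j)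
    (g := fun t => x t j) (g' := fun t => x' t j) (α := α) (β := β) (β₀ := β₀) (M := M)
    (A := D + K * (H + D) + K * (1 + Y + K) * W) (B := D + K * W) (H := K * (1 + Y + K))
    (Hx := K * (1 + Y + K)) (S := K) (L := K) (G := K) (G' := D) (ω := D)
    (m := K * (b - a) ^ (β₀ + γ)) (m' := D * (b - a) ^ (β + γ)) (I := I i j) (I' := I' i j)
    ha hab (hb.trans hT1) hα hα1 hk.1 hk.2 (by positivity) (by positivity) (by positivity)
    (by positivity) K.coe_nonneg K.coe_nonneg K.coe_nonneg D.coe_nonneg D.coe_nonneg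
    (by positivity) (by positivity)
    (fun t ht => h.continuous_slice i j (hsub ht)) (fun t ht => h'.continuous_slice i j (hsub ht))
    ((hxH.apply j).continuousOn hα) ((hxH'.apply j).continuousOn hα) hbound hbound'
    (hxH.apply j)
    (fun s hs t ht => by simpa using (hxD.apply j) s hs t ht)
    (fun t ht => by
      have h1 := norm_le_of_supNorm_le hDC t (hsub ht)
      exact (PiLp.norm_apply_le ((x - x') t) j).trans h1)
    (fun s hs t ht ξ hξ => by
      have h1 := abs_slice_sub_le_of_fieldHolder_le hβ.le hDH i j s (hsub hs) t (hsub ht) ξ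
        (himg' hξ)
      rw [slice_sub_field, slice_sub_field] at h1
      have hx : IsInput T α θ U M K F' x y := ⟨h'.field, h.bound, h.holder, h.mem⟩
      have h2 := hx.abs_slice_sub_slice_sub_le h'.bound h'.mem hU hθ i j (hsub hs) (hsub ht)
        (himg ξ hξ) (by positivity : 0 ≤ |s - t| ^ β) hY0 K.coe_nonneg (hpow1 s hs t ht)
        (hY s hs t ht) (hKpow hxH s hs t ht) (hY' s hs t ht) (hKpow hxH' s hs t ht)
      have h3 := hpow s hs t ht β β₀ hβ₀.le hββ₀
      have h4 : K * (‖(y s - y' s) - (y t - y' t)‖ + ‖(x s - x' s) - (x t - x' t)‖) ≤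
          K * (H + D) * |s - t| ^ β₀ := by
        rw [mul_assoc, add_mul]
        gcongr
        · exact (hΔ s hs t ht).trans (mul_le_mul_of_nonneg_left h3 hH)
        · exact (hxD s hs t ht).trans (mul_le_mul_of_nonneg_left
            (hpow s hs t ht α β₀ hβ₀.le (by linarith)) D.coe_nonneg)
      have h5 : K * ((1 + Y + K) * |s - t| ^ β) ^ θ * (‖y t - y' t‖ + ‖x t - x' t‖) ≤
          K * (1 + Y + K) * W * |s - t| ^ β₀ := by
        calc _ ≤ K * ((1 + Y + K) * |s - t| ^ β₀) * W := by
              gcongr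
              · exact hθpow s hs t ht
              · exact hstate t ht
          _ = _ := by ring
      have h6 := mul_le_mul_of_nonneg_left h3 D.coe_nonneg
      have e : slice F y x i j s ξ - slice F' y' x' i j s ξ
          - (slice F y x i j t ξ - slice F' y' x' i j t ξ)
          = ((slice F y x i j s ξ - slice F' y x i j s ξ)
            - (slice F y x i j t ξ - slice F' y x i j t ξ))
            + ((slice F' y x i j s ξ - slice F' y' x' i j s ξ)
            - (slice F' y x i j t ξ - slice F' y' x' i j t ξ)) := by ring
      rw [e]
      refine (abs_add_le _ _).trans ?_
      linarith)
    (fun t ht ξ hξ => by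
      have h1 := abs_slice_le_of_fieldSup_le hDS i j t (hsub ht) ξ (himg' hξ)
      rw [slice_sub_field] at h1
      have hx : IsInput T α θ U M K F' x y := ⟨h'.field, h.bound, h.holder, h.mem⟩
      have h2 := hx.abs_slice_sub_slice_le h'.bound h'.mem hU hθ i j (hsub ht) (himg ξ hξ)
      have h3 := mul_le_mul_of_nonneg_left (hstate t ht) K.coe_nonneg
      have := abs_sub_le (slice F y x i j t ξ) (slice F' y x i j t ξ) (slice F' y' x' i j t ξ)
      linarith)
    (fun s hs t ht ξ hξ => h'.abs_slice_sub_le hU hθ i j (hsub hs) (hsub ht) hξ (by positivity)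
      hY0 K.coe_nonneg (hpow1 s hs t ht) (hY' s hs t ht) (hKpow hxH' s hs t ht))
    (fun t ht ξ hξ => h'.abs_slice_le i j (hsub ht) hξ)
    (fun s hs t ht ξ η hξ hη => by
      refine (h'.abs_slice_mixed_le hU hθ i j (hsub hs) (hsub ht) hξ hη (by positivity) hY0
        K.coe_nonneg (hpow1 s hs t ht) (hY' s hs t ht) (hKpow hxH' s hs t ht)).trans ?_
      rw [mul_assoc (K : ℝ) (1 + Y + K)]
      gcongr
      exact hθpow s hs t ht)
    (fun t ht ξ η hξ hη => h'.abs_slice_sub_space_le hU hθ i j (hsub ht) hξ hη)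
    (levyMu_le_of_gSeminorm_le hG j ha hab hb hk) hG' (hI i j) (hI' i j)

end Increment

/-! ### The Lipschitz estimate -/

/-- The powers of the length `r ≤ 1` of an interval that occur in the increment estimates,
compared with `r ^ β`, with a gain of `r ^ ε` where the estimates are to be absorbed. -/
lemma rpow_bounds {r α β β₀ γ ε : ℝ} (hr : 0 < r) (hr1 : r ≤ 1) (hβα : β ≤ α) (hγ : 0 ≤ γ)
    (hε : ε ≤ β₀ + γ - β) :
    r ^ (β₀ + γ) ≤ r ^ ε * r ^ β ∧ r ^ (β + γ) ≤ r ^ β ∧ r ^ α ≤ r ^ β := by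
  refine ⟨?_, Real.rpow_le_rpow_of_exponent_ge hr hr1 (by linarith),
    Real.rpow_le_rpow_of_exponent_ge hr hr1 hβα⟩
  rw [← Real.rpow_add hr]
  exact Real.rpow_le_rpow_of_exponent_ge hr hr1 (by linarith)

/-- The constant in the increment estimate for one solution. -/
noncomputable def growthConst (m d : ℕ) (α K : ℝ) : ℝ :=
  m * (d * (K * (1 + K) * K + geomConst α * (2 * (K * K))))

/-- The constant in the increment estimate for the difference of two solutions with local Hölder
constant `Y`. -/
noncomputable def stabilityConst (m d : ℕ) (α K Y : ℝ) : ℝ :=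
  m * (d * ((1 + K + 2 * (K * (1 + Y + K))) * K + K * (1 + Y + K)
    + geomConst α * (2 * ((1 + 2 * K) * K + K))))

lemma growthConst_nonneg (m d : ℕ) {α K : ℝ} (hα : 0 < α) (hK : 0 ≤ K) :
    0 ≤ growthConst m d α K := by
  have := geomConst_nonneg hα
  unfold growthConst; positivity

lemma stabilityConst_nonneg (m d : ℕ) {α K Y : ℝ} (hα : 0 < α) (hK : 0 ≤ K) (hY : 0 ≤ Y) :
    0 ≤ stabilityConst m d α K Y := by
  have := geomConst_nonneg hα
  unfold stabilityConst; positivity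

lemma growth_le (m d : ℕ) {α K H p q u v : ℝ} (hα : 0 < α) (hK : 0 ≤ K) (hH : 0 ≤ H)
    (hp1 : p ≤ 1) (hq : 0 ≤ q) (hu : u ≤ p * q) (hv : v ≤ q) (hp : 0 ≤ p) :
    m * (d * (K * (1 + H + K) * (K * u) + geomConst α * (2 * (K * K)) * v)) ≤
      growthConst m d α K * (1 + H * p) * q := by
  have hg := geomConst_nonneg hα
  have h1 : K * (1 + H + K) * (K * u) ≤ K * (1 + K) * K * (1 + H * p) * q := by
    calc K * (1 + H + K) * (K * u) ≤ K * (1 + H + K) * (K * (p * q)) := by gcongr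
      _ = K * K * ((1 + K) * p + H * p) * q := by ring
      _ ≤ K * K * ((1 + K) * 1 + (1 + K) * (H * p)) * q := by
          have h : (1 + K) * p + H * p ≤ (1 + K) * 1 + (1 + K) * (H * p) := by
            have : 0 ≤ H * p := by positivity
            nlinarith
          gcongr
      _ = _ := by ring
  have h2 : geomConst α * (2 * (K * K)) * v ≤ geomConst α * (2 * (K * K)) * (1 + H * p) * q := by
    have hHp : 0 ≤ H * p * q := by positivity
    have h : v ≤ (1 + H * p) * q := by linarith
    calc _ ≤ geomConst α * (2 * (K * K)) * ((1 + H * p) * q) := by gcongr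
      _ = _ := by ring
  calc _ ≤ (m : ℝ) * (d * (K * (1 + K) * K * (1 + H * p) * q
        + geomConst α * (2 * (K * K)) * (1 + H * p) * q)) := by gcongr
    _ = _ := by unfold growthConst; ring

lemma stability_le (m d : ℕ) {α K Y H D w p q u u' v : ℝ} (hα : 0 < α) (hK : 0 ≤ K)
    (hY : 0 ≤ Y) (hH : 0 ≤ H) (hD : 0 ≤ D) (hw : 0 ≤ w) (hp : 0 ≤ p) (hp1 : p ≤ 1) (hq : 0 ≤ q)
    (hu : u ≤ p * q) (hu' : u' ≤ q) (hv : v ≤ q) :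
    m * (d * (
      (D + K * (H + D) + K * (1 + Y + K) * (w + H * p + D) + K * (1 + Y + K) * D) * (K * u)
      + K * (1 + Y + K) * (D * u')
      + geomConst α * (2 * ((D + K * (w + H * p + D) + K * D) * K + K * D)) * v)) ≤
      stabilityConst m d α K Y * (w + D + H * p) * q := by
  have hg := geomConst_nonneg hα
  have hHp : 0 ≤ H * p := by positivity
  set L := K * (1 + Y + K) with hL
  have hL0 : 0 ≤ L := by positivity
  set Z := w + D + H * p with hZ
  have hZ0 : 0 ≤ Z := by positivity
  have hDZ : D ≤ Z := by linarith
  have hHpH : H * p ≤ H := mul_le_of_le_one_right hH hp1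
  have h1 : (D + K * (H + D) + L * (w + H * p + D) + L * D) * p ≤ (1 + K + 2 * L) * Z := by
    have e1 : D * p ≤ Z := (mul_le_of_le_one_right hD hp1).trans hDZ
    have e2 : (H + D) * p ≤ Z := by
      have := mul_le_of_le_one_right hD hp1
      linarith
    have e3 : (w + H * p + D) * p ≤ Z :=
      (mul_le_of_le_one_right (by positivity) hp1).trans (by linarith)
    calc _ = D * p + K * ((H + D) * p) + L * ((w + H * p + D) * p) + L * (D * p) := by ring
      _ ≤ Z + K * Z + L * Z + L * Z := by gcongr
      _ = _ := by ring
  have h2 : (D + K * (H + D) + L * (w + H * p + D) + L * D) * (K * u) ≤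
      (1 + K + 2 * L) * K * Z * q := by
    calc _ ≤ (D + K * (H + D) + L * (w + H * p + D) + L * D) * (K * (p * q)) := by gcongr
      _ = ((D + K * (H + D) + L * (w + H * p + D) + L * D) * p) * K * q := by ring
      _ ≤ (1 + K + 2 * L) * Z * K * q := by gcongr
      _ = _ := by ring
  have h3 : L * (D * u') ≤ L * Z * q := by
    calc L * (D * u') ≤ L * (D * q) := by gcongr
      _ ≤ L * (Z * q) := by gcongr
      _ = _ := by ring
  have h4 : geomConst α * (2 * ((D + K * (w + H * p + D) + K * D) * K + K * D)) * v ≤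
      geomConst α * (2 * ((1 + 2 * K) * K + K)) * Z * q := by
    calc _ ≤ geomConst α * (2 * ((D + K * (w + H * p + D) + K * D) * K + K * D)) * q := by
          gcongr
      _ ≤ geomConst α * (2 * ((Z + K * Z + K * Z) * K + K * Z)) * q := by
          gcongr
          linarith
      _ = _ := by ring
  calc _ ≤ (m : ℝ) * (d * ((1 + K + 2 * L) * K * Z * q + L * Z * q
        + geomConst α * (2 * ((1 + 2 * K) * K + K)) * Z * q)) := by gcongr
    _ = _ := by unfold stabilityConst; ring

/-- A solution is `β`-Hölder on short intervals, with a constant that depends only on the bounds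
for the data. -/
lemma IsSolution.holderOn {m d : ℕ} {T α β β₀ γ θ ε δ M : ℝ} {U : Set (E m)} {K : ℝ≥0}
    {F : Field m d} {x : ℝ → E d} {y₀ : E m} {y : ℝ → E m} {a b : ℝ}
    (hsol : IsSolution β T x F y₀ y) (h : IsInput T α θ U M K F x y)
    (hU : Convex ℝ U) (hθ : 0 ≤ θ) (hT1 : T ≤ 1) (hβ₀ : 0 < β₀) (hβ₀β : β₀ ≤ β) (hβα : β ≤ α)
    (hα1 : α ≤ 1) (hγ : 0 ≤ γ) (hε0 : 0 ≤ ε) (hε : ε ≤ β₀ + γ - β)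
    (hG : gSeminorm β₀ γ T x ≤ K) (hδ : growthConst m d α K * δ ^ ε ≤ 1 / 2)
    (ha : 0 ≤ a) (hb : b ≤ T) (hab : b - a ≤ δ) :
    HolderOn β (2 * growthConst m d α K) a b y := by
  have hβ : 0 < β := by linarith
  have hα : 0 < α := by linarith
  have hc := growthConst_nonneg m d hα K.coe_nonneg
  have h₀ := norm_sub_le_of_holderSeminorm_le hβ.le
    (ENNReal.coe_toNNReal hsol.holder.ne).symm.le
  refine HolderOn.of_improvement hc (NNReal.coe_nonneg _) (HolderOn.mono h₀ ha hb)
    fun H hH hy s hs t ht hst => ?_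
  have hr := sub_pos.2 hst
  have hr1 : t - s ≤ 1 := by linarith [hs.1, ht.2]
  obtain ⟨hu, -, hv⟩ := rpow_bounds hr hr1 hβα hγ hε
  have hp : 0 ≤ (t - s) ^ ε := by positivity
  have hq : 0 ≤ (t - s) ^ β := by positivity
  refine (hsol.norm_sub_le h hU hθ hT1 hβ₀ hβ₀β hβα hα1 hG (ha.trans hs.1) hst (ht.2.trans hb) hH
    (hy.mono hs.1 ht.2)).trans ((growth_le m d hα K.coe_nonneg hH
      (Real.rpow_le_one hr.le hr1 hε0) hq hu hv hp).trans ?_)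
  refine mul_le_mul_of_nonneg_right ?_ hq
  have h1 : (t - s) ^ ε ≤ δ ^ ε := by
    gcongr; linarith [hs.1, ht.2]
  have h2 : growthConst m d α K * (t - s) ^ ε ≤ 1 / 2 :=
    (mul_le_mul_of_nonneg_left h1 hc).trans hδ
  nlinarith

/-- The Lipschitz estimate over short intervals: the difference of two solutions has there a
`β`-Hölder constant linear in its initial value and in the distance `D` of the data. -/
lemma holderOn_solution_sub {m d : ℕ} {T α β β₀ γ θ ε δ M : ℝ} {U : Set (E m)} {K : ℝ≥0}
    {F F' : Field m d} {x x' : ℝ → E d} {y₀ y₀' : E m} {y y' : ℝ → E m} {a b Y : ℝ}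
    (hsol : IsSolution β T x F y₀ y)
    (hsol' : IsSolution β T x' F' y₀' y') (h : IsInput T α θ U M K F x y)
    (h' : IsInput T α θ U M K F' x' y')
    (hU : Convex ℝ U) (hθ : 0 ≤ θ) (hθ1 : θ ≤ 1) (hT1 : T ≤ 1) (hβ₀ : 0 < β₀)
    (hβ : 0 < β) (hβ₀β : β₀ ≤ θ * β) (hβα : β ≤ α) (hα1 : α ≤ 1)
    (hγ : 0 ≤ γ) (hε0 : 0 ≤ ε) (hεβ : ε ≤ β) (hε : ε ≤ β₀ + γ - β)
    (hG : gSeminorm β₀ γ T x ≤ K) {D : ℝ≥0} (hDG : gSeminorm β γ T (x' - x) ≤ D)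
    (hDα : holderSeminorm α T (x - x') ≤ D) (hDC : supNorm T (x - x') ≤ D)
    (hDH : fieldHolder β T y x (F - F') ≤ D) (hDS : fieldSup T y x (F - F') ≤ D)
    (hY0 : 0 ≤ Y) (hY : HolderOn β Y a b y) (hY' : HolderOn β Y a b y') (hδ0 : 0 ≤ δ)
    (hδ : 2 * stabilityConst m d α K Y * δ ^ ε ≤ 1 / 2) (ha : 0 ≤ a)
    (hb : b ≤ T) (hδab : b - a ≤ δ) :
    HolderOn β (2 * (stabilityConst m d α K Y * (‖(y - y') a‖ + D))) a b (y - y') := by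
  have hα : 0 < α := by linarith
  have hc := stabilityConst_nonneg m d hα K.coe_nonneg hY0
  set c := stabilityConst m d α K Y with hcdef
  refine HolderOn.of_improvement (H₀ := Y + Y) (by positivity) (by positivity) ?_
    fun H hH hΔ s hs t ht hst => ?_
  · intro s hs t ht
    have e : (y - y') s - (y - y') t = (y s - y t) - (y' s - y' t) := by
      simp only [Pi.sub_apply]; abel
    rw [e, add_mul]
    exact (norm_sub_le _ _).trans (add_le_add (hY s hs t ht) (hY' s hs t ht))
  have hr := sub_pos.2 hst
  have hr1 : t - s ≤ 1 := by linarith [hs.1, ht.2]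
  obtain ⟨hu, hu', hv⟩ := rpow_bounds hr hr1 hβα hγ hε
  have hp : 0 ≤ (t - s) ^ ε := by positivity
  have hq : 0 ≤ (t - s) ^ β := by positivity
  have hab : a ≤ b := hs.1.trans hs.2
  have hW : ∀ r ∈ Icc s t, ‖(y - y') r‖ + D ≤ ‖(y - y') s‖ + H * (t - s) ^ ε + D := by
    intro r hr'
    have h1 := hΔ r ⟨hs.1.trans hr'.1, hr'.2.trans ht.2⟩ s hs
    have h2 : |r - s| ^ β ≤ (t - s) ^ ε := by
      rw [abs_of_nonneg (sub_nonneg.2 hr'.1)]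
      calc (r - s) ^ β ≤ (t - s) ^ β := by
            have := sub_nonneg.2 hr'.1
            gcongr; exact hr'.2
        _ ≤ (t - s) ^ ε := Real.rpow_le_rpow_of_exponent_ge hr hr1 hεβ
    have h3 := mul_le_mul_of_nonneg_left h2 hH
    have h4 : ‖(y - y') r‖ ≤ ‖(y - y') r - (y - y') s‖ + ‖(y - y') s‖ := by
      simpa using norm_add_le ((y - y') r - (y - y') s) ((y - y') s)
    linarith
  have h1 := norm_solution_sub_sub_le hsol hsol' h h' hU hθ hθ1 hT1 hβ₀ hβ₀β hβα hα1 hG hDG hDα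
    hDC hDH hDS (ha.trans hs.1) hst (ht.2.trans hb) hY0 (hY.mono hs.1 ht.2) (hY'.mono hs.1 ht.2)
    hH (hΔ.mono hs.1 ht.2) hW
  refine h1.trans ((stability_le m d hα K.coe_nonneg hY0 hH D.coe_nonneg (norm_nonneg _) hp
    (Real.rpow_le_one hr.le hr1 hε0) hq hu hu' hv).trans (mul_le_mul_of_nonneg_right ?_ hq))
  -- moving the base point from `s` to `a` costs another `H δ ^ ε`, which is absorbed as well
  have h2 : (t - s) ^ ε ≤ δ ^ ε := by
    gcongr; linarith [hs.1, ht.2]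
  have h3 : ‖(y - y') s‖ ≤ ‖(y - y') a‖ + H * δ ^ ε := by
    have h4 := hΔ s hs a (left_mem_Icc.2 hab)
    have h5 : |s - a| ^ β ≤ δ ^ ε := by
      have h0 := sub_nonneg.2 hs.1
      rw [abs_of_nonneg h0]
      rcases h0.eq_or_lt with h0' | h0'
      · rw [← h0', Real.zero_rpow hβ.ne']; positivity
      · calc (s - a) ^ β ≤ (s - a) ^ ε :=
              Real.rpow_le_rpow_of_exponent_ge h0' (by linarith [hs.2]) hεβ
          _ ≤ δ ^ ε := by gcongr; linarith [hs.2]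
    have h6 := mul_le_mul_of_nonneg_left h5 hH
    have h7 : ‖(y - y') s‖ ≤ ‖(y - y') s - (y - y') a‖ + ‖(y - y') a‖ := by
      simpa using norm_add_le ((y - y') s - (y - y') a) ((y - y') a)
    linarith
  have h4 := mul_le_mul_of_nonneg_left h2 hH
  calc c * (‖(y - y') s‖ + D + H * (t - s) ^ ε)
      ≤ c * ((‖(y - y') a‖ + H * δ ^ ε) + D + H * δ ^ ε) := by gcongr
    _ = c * (‖(y - y') a‖ + D) + (2 * c * δ ^ ε) * H := by ring
    _ ≤ c * (‖(y - y') a‖ + D) + 1 / 2 * H := by gcongr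
    _ = _ := by ring

end IrregularPath

theorem theorem3p3 (m d : ℕ) (T α β β₀ γ θ : ℝ)
    (hT : 0 < T) (hT1 : T ≤ 1)
    (hβ : 0 < β) (hβα : β ≤ α) (hα : α ≤ 1)
    (hθ : 0 < θ) (hθ1 : θ ≤ 1) (hγ : 0 < γ)
    (h1 : 0 < β - γ) (h2 : β - γ < β₀) (h3 : β₀ < θ * β)
    (M : ℝ) (K : ℝ≥0) :
    ∃ C : ℝ≥0, ∀ (U : Set (IrregularPath.E m)), Convex ℝ U →
      ∀ (F F' : IrregularPath.Field m d) (x x' : ℝ → IrregularPath.E d)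
        (y₀ y₀' : IrregularPath.E m) (y y' : ℝ → IrregularPath.E m),
      (∀ i j, IrregularPath.IsC1Holder T θ U M K (fun p => F p.1 p.2.1 p.2.2 i j)) →
      (∀ i j, IrregularPath.IsC1Holder T θ U M K (fun p => F' p.1 p.2.1 p.2.2 i j)) →
      (∀ t ∈ Icc (0 : ℝ) T, ∀ j, |x t j| ≤ M) →
      (∀ t ∈ Icc (0 : ℝ) T, ∀ j, |x' t j| ≤ M) →
      IrregularPath.holderSeminorm α T x ≤ K →
      IrregularPath.holderSeminorm α T x' ≤ K →
      IrregularPath.gSeminorm β₀ γ T x ≤ K →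
      IrregularPath.gSeminorm β₀ γ T x' ≤ K →
      IrregularPath.IsSolution β T x F y₀ y →
      IrregularPath.IsSolution β T x' F' y₀' y' →
      (∀ t ∈ Icc (0 : ℝ) T, y t ∈ U) →
      (∀ t ∈ Icc (0 : ℝ) T, y' t ∈ U) →
      IrregularPath.holderSeminorm β T (y - y') ≤
        C * (‖y₀ - y₀'‖ₑ
          + IrregularPath.gSeminorm β γ T (x' - x)
          + IrregularPath.holderSeminorm α T (x - x')
          + IrregularPath.supNorm T (x - x')
          + IrregularPath.fieldHolder β T y x (F - F')
          + IrregularPath.fieldSup T y x (F - F')) := by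
  have hα0 : 0 < α := hβ.trans_le hβα
  have hβ₀ : 0 < β₀ := h1.trans h2
  have hβ₀β : β₀ ≤ β := h3.le.trans (mul_le_of_le_one_left hβ.le hθ1)
  set ε := min β (β₀ + γ - β) with hε
  have hε0 : 0 < ε := lt_min hβ (by linarith)
  have hεβ : ε ≤ β := min_le_left _ _
  have hεγ : ε ≤ β₀ + γ - β := min_le_right _ _
  have hg0 := IrregularPath.growthConst_nonneg m d hα0 K.coe_nonneg
  set Y := 2 * IrregularPath.growthConst m d α K with hY
  have hY0 : 0 ≤ Y := by positivity
  have hs0 := IrregularPath.stabilityConst_nonneg m d hα0 K.coe_nonneg hY0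
  set c := IrregularPath.stabilityConst m d α K Y with hc
  obtain ⟨δ₁, hδ₁, hδ₁1, hδ₁c⟩ := IrregularPath.exists_small_rpow hg0 hε0
  obtain ⟨δ₂, hδ₂, -, hδ₂c⟩ :=
    IrregularPath.exists_small_rpow (by positivity : 0 ≤ 2 * c) hε0
  set δ := min δ₁ δ₂ with hδdef
  have hδ : 0 < δ := lt_min hδ₁ hδ₂
  have hδg : IrregularPath.growthConst m d α K * δ ^ ε ≤ 1 / 2 := by
    refine le_trans ?_ hδ₁c
    gcongr
    exact min_le_left _ _
  have hδc : 2 * c * δ ^ ε ≤ 1 / 2 := by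
    refine le_trans ?_ hδ₂c
    gcongr
    exact min_le_right _ _
  set C₀ := (2 * c + 2 / δ ^ β) * (1 + 2 * c) ^ ⌈1 / δ⌉₊ with hC₀
  have hC₀0 : 0 ≤ C₀ := by positivity
  -- the summand `1` keeps the bound infinite when the distance of the data is infinite
  refine ⟨(2 * C₀ + 1).toNNReal, ?_⟩
  intro U hU F F' x x' y₀ y₀' y y' hF hF' hx hx' hxα hxα' hxG hxG' hsol hsol' hyU hyU'
  have hin : IrregularPath.IsInput T α θ U M K F x y :=
    ⟨hF, hx, IrregularPath.norm_sub_le_of_holderSeminorm_le hα0.le hxα, hyU⟩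
  have hin' : IrregularPath.IsInput T α θ U M K F' x' y' :=
    ⟨hF', hx', IrregularPath.norm_sub_le_of_holderSeminorm_le hα0.le hxα', hyU'⟩
  set S := ‖y₀ - y₀'‖ₑ + IrregularPath.gSeminorm β γ T (x' - x)
    + IrregularPath.holderSeminorm α T (x - x') + IrregularPath.supNorm T (x - x')
    + IrregularPath.fieldHolder β T y x (F - F') + IrregularPath.fieldSup T y x (F - F') with hS
  rcases eq_or_ne S ⊤ with hST | hST
  · have hC : ((2 * C₀ + 1).toNNReal : ℝ≥0∞) ≠ 0 := by
      rw [ENNReal.coe_ne_zero]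
      exact (Real.toNNReal_pos.2 (by positivity)).ne'
    rw [hST, ENNReal.mul_top hC]
    exact le_top
  obtain ⟨D, hD⟩ : ∃ D : ℝ≥0, (D : ℝ≥0∞) = S := ⟨S.toNNReal, ENNReal.coe_toNNReal hST⟩
  have e6 : IrregularPath.fieldSup T y x (F - F') ≤ D := hD ▸ le_add_self
  have s5 : ‖y₀ - y₀'‖ₑ + IrregularPath.gSeminorm β γ T (x' - x)
    + IrregularPath.holderSeminorm α T (x - x') + IrregularPath.supNorm T (x - x')
    + IrregularPath.fieldHolder β T y x (F - F') ≤ D := hD ▸ le_self_add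
  have e5 : IrregularPath.fieldHolder β T y x (F - F') ≤ D := le_add_self.trans s5
  have s4 := le_self_add.trans s5
  have e4 : IrregularPath.supNorm T (x - x') ≤ D := le_add_self.trans s4
  have s3 := le_self_add.trans s4
  have e3 : IrregularPath.holderSeminorm α T (x - x') ≤ D := le_add_self.trans s3
  have s2 := le_self_add.trans s3
  have e2 : IrregularPath.gSeminorm β γ T (x' - x) ≤ D := le_add_self.trans s2
  have e1 : ‖y₀ - y₀'‖ ≤ D := by exact_mod_cast le_self_add.trans s2
  have hloc : ∀ a b, 0 ≤ a → a < b → b ≤ T → b - a ≤ δ →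
      ‖(y - y') b - (y - y') a‖ ≤ 2 * c * (‖(y - y') a‖ + D) * (b - a) ^ β := by
    intro a b ha hab hb hδab
    have hYy := hsol.holderOn hin hU hθ.le hT1 hβ₀ hβ₀β hβα hα hγ.le hε0.le hεγ hxG hδg ha hb
      hδab
    have hYy' := hsol'.holderOn hin' hU hθ.le hT1 hβ₀ hβ₀β hβα hα hγ.le hε0.le hεγ hxG' hδg
      ha hb hδab
    have h := IrregularPath.holderOn_solution_sub hsol hsol' hin hin' hU hθ.le hθ1 hT1 hβ₀ hβ h3.le
      hβα hα hγ.le hε0.le hεβ hεγ hxG e2 e3 e4 e5 e6 hY0 hYy hYy' hδ.le hδc ha hb hδab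
      b (right_mem_Icc.2 hab.le) a (left_mem_Icc.2 hab.le)
    rwa [abs_of_pos (sub_pos.2 hab), ← mul_assoc 2 c] at h
  have hglob := IrregularPath.HolderOn.of_local hβ.le (by positivity) hδ D.coe_nonneg hT1 hloc
  rw [Pi.sub_apply, hsol.apply_zero hT.le, hsol'.apply_zero hT.le] at hglob
  rw [← hD, ← ENNReal.coe_mul]
  refine IrregularPath.holderSeminorm_le hβ.le fun s hs t ht => (hglob s hs t ht).trans ?_
  rw [NNReal.coe_mul, Real.coe_toNNReal _ (by positivity)]
  refine mul_le_mul_of_nonneg_right ?_ (by positivity)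
  calc C₀ * (‖y₀ - y₀'‖ + D) ≤ C₀ * (D + D) := by gcongr
    _ ≤ (2 * C₀ + 1) * D := by linarith [D.coe_nonneg]
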